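/- Let $q$ be a prime power and let $t\ge 0$ be an integer, both fixed. Let $x\mapsto x^{\sigma}=x^q$ be the involution of $\mathbf F_{q^2}$ with fixed field $\mathbf F_q$, let $$\mathrm{GU}_n(q)=\{A\in \mathrm{GL}_n(\mathbf F_{q^2}) : A\,(A^{\sigma})^{T}=1\},$$ where $A^\sigma$ is $A$ with $\sigma$ applied to every entry, and let $\mathrm{SU}_n(q)$ be its subgroup of elements of determinant $1$. For a polynomial $\phi\in\mathbf F_{q^2}[z]$ with $\phi(0)\neq 0$ define its conjugate by $$\tilde\phi(z)=\phi(0)^{-\sigma}\,z^{\deg\phi}\,\phi^{\sigma}(1/z),$$ where $\phi^\sigma$ is $\phi$ with $\sigma$ applied to every coefficient. Let $\tilde N(q;j)$ be the number of monic irreducible $\phi\in\mathbf F_{q^2}[z]$ of degree $j$ with $\phi(0)\ne0$ and $\phi=\tilde\phi$, and let $\tilde M(q;j)$ be the number of unordered pairs $\{\phi,\tilde\phi\}$ of monic irreducible polynomials of degree $j$ over $\mathbf F_{q^2}$ with $\phi(0)\neq 0$ and $\phi\neq\tilde\phi$. Theorem. For every choice of cosets $C_n$ of $\mathrm{SU}_n(q)$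 in $\mathrm{GU}_n(q)$ (one for each $n$), the proportion of elements of $C_n$ whose characteristic polynomial has no irreducible factor over $\mathbf F_{q^2}$ of degree at most $t$ converges, as $n\to\infty$, to $$\prod_{j=1}^{t}\left(\prod_{i\ge1}\Bigl(1+\frac1{(-q)^{ij}}\Bigr)^{\tilde N(q;j)}\;\prod_{i\ge1}\Bigl(1-\frac1{q^{2ij}}\Bigr)^{\tilde M(q;j)}\right),$$ where all these infinite products converge (unconditionally). -/

import Mathlib

open Polynomial Filter Topology
open scoped Pointwise

noncomputable section

namespace UnitaryCoset

variable (F K : Type*) [Field F] [Fintype F] [Field K] [Algebra F K]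

/-- The map `x ↦ x ^ q` on `K`, where `q` is the cardinality of `F`.  When `K` is quadratic over `F`
this is the involution `σ` of `K = 𝔽_{q²}` with fixed field `F = 𝔽_q`. -/
abbrev conj : K →+* K := (FiniteField.frobeniusAlgHom F K : K →+* K)

theorem conj_apply (x : K) : conj F K x = x ^ Fintype.card F := rfl

/-- The general unitary group `GU_n(q)`: invertible matrices `A` over `K = 𝔽_{q²}` with
`A * (Aᵟ)ᵀ = 1`, where `Aᵟ` is obtained by raising each entry to the power `q`. -/
def GU (n : ℕ) : Subgroup (Matrix.GeneralLinearGroup (Fin n) K) where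
  carrier := {A | (A : Matrix (Fin n) (Fin n) K) *
    ((A : Matrix (Fin n) (Fin n) K).map (conj F K)).transpose = 1}
  one_mem' := by
    simp [Matrix.map_one]
  mul_mem' := by
    intro A B hA hB
    simp only [Set.mem_ofPred_eq] at hA hB ⊢
    rw [Units.val_mul, Matrix.map_mul, Matrix.transpose_mul, Matrix.mul_assoc,
      ← Matrix.mul_assoc (B : Matrix (Fin n) (Fin n) K), hB, Matrix.one_mul, hA]
  inv_mem' := by
    intro A hA
    simp only [Set.mem_ofPred_eq] at hA ⊢
    have h1 : ((A⁻¹ : Matrix.GeneralLinearGroup (Fin n) K) : Matrix (Fin n) (Fin n) K) =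
        ((A : Matrix (Fin n) (Fin n) K).map (conj F K)).transpose :=
      Units.inv_eq_of_mul_eq_one_right hA
    have h2 : (A : Matrix (Fin n) (Fin n) K) *
        ((A⁻¹ : Matrix.GeneralLinearGroup (Fin n) K) : Matrix (Fin n) (Fin n) K) = 1 :=
      Units.mul_inv A
    have h3 := congrArg (fun M => (M.map (conj F K)).transpose) h2
    simp only [Matrix.map_mul, Matrix.transpose_mul] at h3
    rw [← h1, Matrix.map_one _ (map_zero _) (map_one _), Matrix.transpose_one] at h3
    exact mul_eq_one_comm.mp h3

/-- The special unitary group `SU_n(q)`, as a subgroup of `GU_n(q)`: the kernel of `det`. -/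
def SU (n : ℕ) : Subgroup (GU F K n) :=
  ((Matrix.GeneralLinearGroup.det : Matrix.GeneralLinearGroup (Fin n) K →* Kˣ).comp
    (GU F K n).subtype).ker

/-- The conjugate `φ̃(z) = φ(0)^{-σ} z^{deg φ} φ^σ(1/z)` of a polynomial `φ` with `φ(0) ≠ 0`.
(It is only used for such `φ`.) -/
def tildeConj (φ : K[X]) : K[X] :=
  C (conj F K (φ.coeff 0))⁻¹ * (φ.map (conj F K)).reverse

/-- `Ñ(q;j)`: the number of monic irreducible polynomials `φ` of degree `j` over `𝔽_{q²}` with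
nonzero constant term and `φ = φ̃`. -/
def tildeN (j : ℕ) : ℕ :=
  Set.ncard {φ : K[X] | φ.Monic ∧ Irreducible φ ∧ φ.natDegree = j ∧ φ.coeff 0 ≠ 0 ∧
    φ = tildeConj F K φ}

/-- `M̃(q;j)`: the number of unordered pairs `{φ, φ̃}` of monic irreducible polynomials of degree
`j` over `𝔽_{q²}` with nonzero constant term and `φ ≠ φ̃`. -/
def tildeM (j : ℕ) : ℕ :=
  Set.ncard {p : Sym2 K[X] | ∃ φ : K[X], φ.Monic ∧ Irreducible φ ∧ φ.natDegree = j ∧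
    φ.coeff 0 ≠ 0 ∧ φ ≠ tildeConj F K φ ∧ p = s(φ, tildeConj F K φ)}

variable {K} in
/-- The characteristic polynomial of `A` has no irreducible factor of degree at most `t`. -/
def NoSmallFactor (t : ℕ) {n : ℕ} (A : Matrix (Fin n) (Fin n) K) : Prop :=
  ∀ φ : K[X], Irreducible φ → φ ∣ A.charpoly → t < φ.natDegree

variable {F K} in
/-- The proportion of elements of `S ⊆ GU_n(q)` whose characteristic polynomial has no irreducible
factor of degree at most `t`. -/
def proportion (t : ℕ) {n : ℕ} (S : Set (GU F K n)) : ℝ :=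
  (Set.ncard {A : GU F K n | A ∈ S ∧
    NoSmallFactor t ((A : Matrix.GeneralLinearGroup (Fin n) K) : Matrix (Fin n) (Fin n) K)} : ℝ) /
    (Set.ncard S : ℝ)

end UnitaryCoset

end

noncomputable section

namespace UnitaryCoset

/-! ### Trace and norm equations in a quadratic extension of finite fields -/

section FieldFacts

variable {F K : Type*} [Field F] [Fintype F] [Field K] [Algebra F K]

/-! The method is inclusion-exclusion by moments. For a tuple `k` of multiplicities, indexed by the
finitely many monic irreducible `φ ≠ X` of degree at most `t`, let `M_k` be the sum of the modules
`(K[X]/φ)^(k φ)`, with `T` multiplication by `X`. The number of `K[X]`-embeddings of `M_k` into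
`K^n`, with `X` acting as `A`, is a product over `φ` of `∏ i < k φ, (Q^w - Q^i)`, where `Q = |K|^deg
φ` and `w` is the dimension of `ker φ(A)` over `K[X]/φ`. A q-binomial inversion expresses the
indicator of "all `w` vanish" as a series in these numbers (`summable_and_tsum_multiCoef`), so it
suffices to average them over the coset.

An embedding `f` with `f T = A f` pulls the standard form back to a `T`-invariant Hermitian form `β`
on `M_k`. By Witt's theorem, and a spare coordinate that absorbs the determinant, `SU_n` is
transitive on the isometric embeddings of `(M_k, β)` once `n > 2 dim M_k`. An orbit count
(`card_coset_smul_eq`) then shows that each `β` contributes exactly 1 to the average, whichever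
coset is taken. The average is therefore the number of invariant Hermitian forms on `M_k`, which is
`∏ q^(deg φ * k φ * k φ̃)` (`ncard_invHerm`).

For every `n` the average is at most `|Kˣ|` times that number, so dominated convergence gives the
limit as a series over `k` (`tendsto_proportion_tsum`). The series factors over the orbits of `φ ↦
φ̃`, and Euler-type identities evaluate the factors: `tsum_selfCoef` for fixed points, `hasSum_pair`
for pairs. A self-conjugate `φ` has odd degree `j`, which is why `-q^j` can be written `(-q)^j`. -/

theorem finite_of_finrank_eq_two (hK : Module.finrank F K = 2) : Finite K :=
  have : FiniteDimensional F K := FiniteDimensional.of_finrank_pos (by omega)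
  Module.finite_of_finite F

theorem card_eq_sq (hK : Module.finrank F K = 2) : Nat.card K = Fintype.card F ^ 2 := by
  have := finite_of_finrank_eq_two hK
  rw [Module.natCard_eq_pow_finrank (K := F), hK, Nat.card_eq_fintype_card]

theorem conj_conj (hK : Module.finrank F K = 2) (x : K) : conj F K (conj F K x) = x := by
  have := finite_of_finrank_eq_two hK
  have := Fintype.ofFinite K
  rw [conj_apply, conj_apply, ← pow_mul, ← pow_two, ← card_eq_sq hK, Nat.card_eq_fintype_card,
    FiniteField.pow_card]

theorem exists_add_conj_eq_one (hK : Module.finrank F K = 2) : ∃ x : K, x + conj F K x = 1 := by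
  have := finite_of_finrank_eq_two hK
  obtain ⟨x, hx⟩ := Algebra.trace_surjective F K 1
  refine ⟨x, ?_⟩
  have := FiniteField.algebraMap_trace_eq_sum_pow F K x
  rw [hx, hK] at this
  simpa [Finset.sum_range_succ, conj_apply, Nat.card_eq_fintype_card] using this.symm

theorem exists_mul_conj_eq_neg_one (hK : Module.finrank F K = 2) :
    ∃ x : K, x * conj F K x = -1 := by
  have := finite_of_finrank_eq_two hK
  obtain ⟨x, hx⟩ := FiniteField.norm_surjective F K (-1)
  refine ⟨x, ?_⟩
  have := FiniteField.algebraMap_norm_eq_prod_pow F K x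
  rw [hx, hK] at this
  simpa [Finset.prod_range_succ, conj_apply, Nat.card_eq_fintype_card] using this.symm

theorem exists_conj_ne (hK : Module.finrank F K = 2) : ∃ x : K, conj F K x ≠ x := by
  have := finite_of_finrank_eq_two hK
  have := Fintype.ofFinite K
  by_contra! h
  have h1 : FiniteField.frobeniusAlgHom F K = 1 := by
    ext x; exact h x
  have := FiniteField.orderOf_frobeniusAlgHom F K
  rw [h1, orderOf_one, hK] at this
  omega

/-- The trace-type equation behind quasi-reflections has a nonzero solution. -/
theorem exists_ne_zero_add_conj_add (hK : Module.finrank F K = 2) (c : K) (hc : conj F K c = c) :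
    ∃ a : K, a ≠ 0 ∧ a + conj F K a + a * conj F K a * c = 0 := by
  -- Dividing by `a * conj a` linearises the equation in `b = a⁻¹`; what remains is a trace
  -- equation.
  suffices ∃ b : K, b ≠ 0 ∧ b + conj F K b + c = 0 by
    obtain ⟨b, hb, h⟩ := this
    have hb' : conj F K b ≠ 0 := by simpa using hb
    refine ⟨b⁻¹, inv_ne_zero hb, ?_⟩
    rw [map_inv₀]
    field_simp
    linear_combination h
  by_cases h0 : c = 0
  · obtain ⟨x, hx⟩ := exists_conj_ne hK
    refine ⟨conj F K x - x, sub_ne_zero.2 hx, ?_⟩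
    rw [map_sub, conj_conj hK, h0]; ring
  · obtain ⟨x, hx⟩ := exists_add_conj_eq_one hK
    refine ⟨-c * x, mul_ne_zero (neg_ne_zero.2 h0) ?_, ?_⟩
    · rintro rfl; simp at hx
    · rw [map_mul, map_neg, hc]; linear_combination -c * hx

end FieldFacts

/-! ### The Hermitian form, quasi-reflections and Witt's theorem -/

section Form

variable {F K : Type*} [Field F] [Fintype F] [Field K] [Algebra F K]

variable (F) in
/-- The standard Hermitian form on `K ^ n`. -/
def herm {n : ℕ} (x y : Fin n → K) : K := ∑ i, x i * conj F K (y i)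

variable {n : ℕ}

theorem herm_add_left (x y z : Fin n → K) : herm F (x + y) z = herm F x z + herm F y z := by
  simp [herm, add_mul, Finset.sum_add_distrib]

theorem herm_add_right (x y z : Fin n → K) : herm F x (y + z) = herm F x y + herm F x z := by
  simp only [herm, Pi.add_apply, map_add, mul_add, Finset.sum_add_distrib]

theorem herm_smul_left (a : K) (x y : Fin n → K) : herm F (a • x) y = a * herm F x y := by
  simp [herm, Finset.mul_sum, mul_assoc]

theorem herm_smul_right (a : K) (x y : Fin n → K) :
    herm F x (a • y) = conj F K a * herm F x y := by
  simp only [herm, Pi.smul_apply, smul_eq_mul, map_mul, Finset.mul_sum]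
  exact Finset.sum_congr rfl fun i _ => by ring

theorem herm_sub_left (x y z : Fin n → K) : herm F (x - y) z = herm F x z - herm F y z := by
  simp [herm, sub_mul, Finset.sum_sub_distrib]

theorem herm_sub_right (x y z : Fin n → K) : herm F x (y - z) = herm F x y - herm F x z := by
  simp only [herm, Pi.sub_apply, map_sub, mul_sub, Finset.sum_sub_distrib]

theorem conj_herm (hK : Module.finrank F K = 2) (x y : Fin n → K) :
    conj F K (herm F x y) = herm F y x := by
  simp only [herm, map_sum, map_mul, conj_conj hK]
  exact Finset.sum_congr rfl fun i _ => mul_comm _ _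

/-- A vector outside a subspace pairs nontrivially with some vector orthogonal to it. -/
theorem exists_herm_ne_zero (hK : Module.finrank F K = 2) (H : Submodule K (Fin n → K))
    (x : Fin n → K) (hx : x ∉ H) :
    ∃ w : Fin n → K, herm F x w ≠ 0 ∧ ∀ v ∈ H, herm F v w = 0 := by
  obtain ⟨f, hf, hH⟩ := Submodule.exists_le_ker_of_notMem hx
  refine ⟨fun i => conj F K (f (Pi.single i 1)), ?_⟩
  have key : ∀ v, herm F v (fun i => conj F K (f (Pi.single i 1))) = f v := by
    intro v
    rw [LinearMap.pi_apply_eq_sum_univ f v]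
    refine Finset.sum_congr rfl fun i _ => ?_
    rw [conj_conj hK, smul_eq_mul]
    congr 2
    ext j
    simp [Pi.single_apply, eq_comm]
  exact ⟨by rw [key]; exact hf, fun v hv => by rw [key]; exact hH hv⟩

theorem herm_mulVec (A : Matrix (Fin n) (Fin n) K)
    (h : A * (A.map (conj F K)).transpose = 1) (x y : Fin n → K) :
    herm F (A.mulVec x) (A.mulVec y) = herm F x y := by
  have e : ∀ (u v : Fin n → K), herm F u v = dotProduct u (conj F K ∘ v) := fun u v => rfl
  have h' : A.transpose * A.map (conj F K) = 1 := by
    have := congrArg Matrix.transpose (mul_eq_one_comm.mp h)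
    simpa [Matrix.transpose_mul] using this
  have hm : conj F K ∘ A.mulVec y = (A.map (conj F K)).mulVec (conj F K ∘ y) := by
    ext i
    exact RingHom.map_mulVec _ _ _ _
  rw [e, e, hm, Matrix.dotProduct_mulVec, ← Matrix.vecMul_transpose, Matrix.vecMul_vecMul, h',
    Matrix.vecMul_one]

/-- A matrix satisfying the unitary identity, as an element of the unitary group. -/
def mkGU (A : Matrix (Fin n) (Fin n) K) (h : A * (A.map (conj F K)).transpose = 1) : GU F K n :=
  ⟨⟨A, (A.map (conj F K)).transpose, h, mul_eq_one_comm.mp h⟩, h⟩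

/-- The linear map of a unitary matrix. -/
def act (A : GU F K n) : (Fin n → K) →ₗ[K] (Fin n → K) :=
  Matrix.mulVecLin ((A : Matrix.GeneralLinearGroup (Fin n) K) : Matrix (Fin n) (Fin n) K)

theorem act_mkGU (A : Matrix (Fin n) (Fin n) K) (h : A * (A.map (conj F K)).transpose = 1)
    (x : Fin n → K) : act (mkGU A h) x = A.mulVec x := rfl

theorem act_one : act (1 : GU F K n) = LinearMap.id := by
  simp [act]

theorem act_mul (A B : GU F K n) : act (A * B) = act A ∘ₗ act B := by
  simp [act, Matrix.mulVecLin_mul]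

theorem act_injective (A : GU F K n) : Function.Injective (act A) := by
  refine Function.LeftInverse.injective (g := act A⁻¹) fun x => ?_
  rw [← LinearMap.comp_apply, ← act_mul, inv_mul_cancel, act_one, LinearMap.id_apply]

theorem herm_act (A : GU F K n) (x y : Fin n → K) : herm F (act A x) (act A y) = herm F x y :=
  herm_mulVec _ A.2 x y

/-- Quasi-reflections are isometries. -/
theorem exists_quasiReflection (hK : Module.finrank F K = 2) (w : Fin n → K) (a : K)
    (ha : a + conj F K a + a * conj F K a * herm F w w = 0) :
    ∃ A : GU F K n, ∀ x, act A x = x + (a * herm F x w) • w := by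
  have h1 : ((1 + a • Matrix.vecMulVec w (conj F K ∘ w)).map (conj F K)).transpose =
      1 + conj F K a • Matrix.vecMulVec w (conj F K ∘ w) := by
    ext i j
    simp only [Matrix.transpose_apply, Matrix.map_apply, Matrix.add_apply, Matrix.smul_apply,
      Matrix.vecMulVec_apply, map_add, map_mul, smul_eq_mul, Function.comp_apply, conj_conj hK,
      Matrix.one_apply, eq_comm (a := i), mul_comm (w i)]
    split_ifs <;> simp
  have h2 : Matrix.vecMulVec w (conj F K ∘ w) * Matrix.vecMulVec w (conj F K ∘ w) =
      herm F w w • Matrix.vecMulVec w (conj F K ∘ w) := by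
    ext i j
    simp only [Matrix.mul_apply, Matrix.vecMulVec_apply, Function.comp_apply, Matrix.smul_apply,
      smul_eq_mul, herm, Finset.sum_mul]
    exact Finset.sum_congr rfl fun k _ => by ring
  refine ⟨mkGU (1 + a • Matrix.vecMulVec w (conj F K ∘ w)) ?_, fun x => ?_⟩
  · simp only [h1, mul_add, add_mul, Matrix.smul_mul, Matrix.mul_smul, h2, one_mul, mul_one,
      smul_smul]
    rw [add_assoc, ← add_smul, ← add_smul]
    convert add_zero (1 : Matrix (Fin n) (Fin n) K) using 2
    convert zero_smul K _ using 2
    rw [← ha]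
    ring
  · rw [act_mkGU, Matrix.add_mulVec, Matrix.one_mulVec, Matrix.smul_mulVec,
      Matrix.vecMulVec_mulVec, op_smul_eq_smul, smul_smul, dotProduct_comm]
    rfl

/-- Extension step of Witt's theorem: `x` can be moved to `y` by an isometry fixing `H`. -/
theorem exists_isometry_fixing (hK : Module.finrank F K = 2) (H : Submodule K (Fin n → K))
    (x y : Fin n → K) (hx : x ∉ H) (hy : y ∉ H) (hxy : herm F x x = herm F y y)
    (hH : ∀ v ∈ H, herm F v x = herm F v y) :
    ∃ A : GU F K n, (∀ v ∈ H, act A v = v) ∧ act A x = y := by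
  -- Generic case: the quasi-reflection along `x - y` with coefficient `-1/⟨x, x - y⟩` sends `x` to
  -- `y`, and it fixes `H` because `x - y` is orthogonal to `H`. It is an isometry because `⟨x, x⟩ =
  -- ⟨y, y⟩` makes `⟨x - y, x - y⟩` the trace of `⟨x, x - y⟩`.
  have main : ∀ y : Fin n → K, herm F x x = herm F y y → (∀ v ∈ H, herm F v x = herm F v y) →
      herm F x y ≠ herm F x x → ∃ A : GU F K n, (∀ v ∈ H, act A v = v) ∧ act A x = y := by
    intro y hxy hH hne
    have hc : herm F x (x - y) ≠ 0 := by
      rw [herm_sub_right]; exact sub_ne_zero.2 hne.symm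
    have hc' : conj F K (herm F x (x - y)) ≠ 0 := by simpa using hc
    have hw : herm F (x - y) (x - y) = herm F x (x - y) + conj F K (herm F x (x - y)) := by
      rw [conj_herm hK]
      simp only [herm_sub_left, herm_sub_right, hxy]; ring
    obtain ⟨A, hA⟩ := exists_quasiReflection (F := F) hK (x - y) (-(herm F x (x - y))⁻¹) (by
      rw [hw, map_neg, map_inv₀]; field_simp; ring)
    refine ⟨A, fun v hv => ?_, ?_⟩
    · rw [hA, herm_sub_right v, hH v hv]; simp
    · rw [hA, neg_mul, inv_mul_cancel₀ hc]; simp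
  by_cases hne : herm F x y = herm F x x
  swap
  · exact main y hxy hH hne
  -- Degenerate case: `y` is first displaced by a quasi-reflection along some `w` orthogonal to `H`
  -- and to neither `x` nor `y`, which changes `⟨x, y⟩` and restores the generic case. One of `u`,
  -- `v`, `u + v` serves as `w`.
  obtain ⟨u, hu, huH⟩ := exists_herm_ne_zero (F := F) hK H x hx
  obtain ⟨v, hv, hvH⟩ := exists_herm_ne_zero (F := F) hK H y hy
  obtain ⟨w, hwx, hwy, hwH⟩ : ∃ w, herm F x w ≠ 0 ∧ herm F y w ≠ 0 ∧
      ∀ z ∈ H, herm F z w = 0 := by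
    by_cases h1 : herm F y u = 0
    · by_cases h2 : herm F x v = 0
      · refine ⟨u + v, ?_, ?_, fun z hz => ?_⟩
        · rwa [herm_add_right, h2, add_zero]
        · rwa [herm_add_right, h1, zero_add]
        · rw [herm_add_right, huH z hz, hvH z hz, add_zero]
      · exact ⟨v, h2, hv, hvH⟩
    · exact ⟨u, hu, h1, huH⟩
  obtain ⟨a, ha0, ha⟩ := exists_ne_zero_add_conj_add hK (herm F w w) (conj_herm hK w w)
  obtain ⟨A, hA⟩ := exists_quasiReflection hK w a ha
  have hAH : ∀ z ∈ H, act A z = z := fun z hz => by rw [hA, hwH z hz]; simp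
  obtain ⟨B, hBH, hBx⟩ := main (act A y) (by rw [herm_act, hxy])
    (fun z hz => by
      rw [hH z hz]
      conv_rhs => rw [← hAH z hz, herm_act])
    (by
      rw [hA, herm_add_right, hne, herm_smul_right]
      intro h
      have h0 : conj F K (a * herm F y w) * herm F x w = 0 := by linear_combination h
      simp [ha0, hwx, hwy] at h0)
  refine ⟨A⁻¹ * B, fun z hz => ?_, ?_⟩
  · apply act_injective A
    rw [← LinearMap.comp_apply, ← act_mul, mul_inv_cancel_left, hBH z hz, hAH z hz]
  · apply act_injective A
    rw [← LinearMap.comp_apply, ← act_mul, mul_inv_cancel_left, hBx]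

/-- Witt's extension theorem, for two embeddings of a finite-dimensional space. -/
theorem exists_act_comp_eq (hK : Module.finrank F K = 2) {M : Type*} [AddCommGroup M] [Module K M]
    [Module.Finite K M] (f g : M →ₗ[K] (Fin n → K)) (hf : Function.Injective f)
    (hg : Function.Injective g) (h : ∀ x y, herm F (f x) (f y) = herm F (g x) (g y)) :
    ∃ A : GU F K n, act A ∘ₗ f = g := by
  classical
  have key : ∀ s : Finset M, ∃ A : GU F K n,
      ∀ x ∈ Submodule.span K (s : Set M), act A (f x) = g x := by
    intro s
    induction s using Finset.induction_on with
    | empty =>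
      refine ⟨1, fun x hx => ?_⟩
      simp only [Finset.coe_empty, Submodule.span_empty, Submodule.mem_bot] at hx
      simp [hx]
    | insert v s _ ih =>
      obtain ⟨A, hA⟩ := ih
      by_cases hv : v ∈ Submodule.span K (s : Set M)
      · exact ⟨A, by rwa [Finset.coe_insert, Submodule.span_insert_eq_span hv]⟩
      have hmem : ∀ k : M →ₗ[K] (Fin n → K), Function.Injective k →
          (∀ x ∈ Submodule.span K (s : Set M), k x = g x) →
          k v ∉ (Submodule.span K (s : Set M)).map g := by
        rintro k hk hkg ⟨x, hx, hxv⟩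
        rw [← hkg x hx] at hxv
        exact hv (hk hxv ▸ hx)
      -- `B` fixes the part already placed by `A`, so `B * A` extends the agreement to `v`.
      obtain ⟨B, hB, hBv⟩ := exists_isometry_fixing hK ((Submodule.span K (s : Set M)).map g)
        (act A (f v)) (g v) (hmem (act A ∘ₗ f) ((act_injective A).comp hf) hA)
        (hmem g hg fun _ _ => rfl) (by rw [herm_act, h]) (by
          rintro _ ⟨x, hx, rfl⟩
          conv_lhs => rw [← hA x hx, herm_act, h])
      refine ⟨B * A, fun x hx => ?_⟩
      rw [Finset.coe_insert, Submodule.mem_span_insert] at hx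
      obtain ⟨c, z, hz, rfl⟩ := hx
      rw [act_mul, LinearMap.comp_apply, map_add, map_add, map_add, map_smul, map_smul, map_smul,
        hBv, hA z hz, hB _ ⟨z, hz, rfl⟩, map_add, map_smul]
  obtain ⟨s, hs⟩ := (Module.Finite.fg_top : (⊤ : Submodule K M).FG)
  obtain ⟨A, hA⟩ := key s
  exact ⟨A, LinearMap.ext fun x => hA x (hs ▸ Submodule.mem_top)⟩

end Form

/-! ### Orbit counting over a coset -/

section GroupCounting

/-- For fixed `x`, transitivity of `H` makes the elements of `gH` taking `x` to `T x` a translate of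
the stabiliser of `x` in `H`, of size `|H| / |X|`. Summing over `x` gives `|H|`; neither `g` nor `T`
matters, whence the independence of the coset in the theorem. -/
theorem card_coset_smul_eq {G X : Type*} [Group G] [Finite G] [MulAction G X] [Finite X]
    [Nonempty X] (H : Subgroup G) (hH : ∀ x y : X, ∃ h ∈ H, h • x = y) (g : G) (T : X → X) :
    Nat.card {p : G × X // p.1 ∈ g • (H : Set G) ∧ p.1 • p.2 = T p.2} = Nat.card H := by
  classical
  have := Fintype.ofFinite X
  have hpre : MulAction.IsPretransitive H X :=
    ⟨fun x y => by obtain ⟨h, hh, e⟩ := hH x y; exact ⟨⟨h, hh⟩, e⟩⟩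
  have e1 : {p : G × X // p.1 ∈ g • (H : Set G) ∧ p.1 • p.2 = T p.2} ≃
      Σ x : X, {a : G // a ∈ g • (H : Set G) ∧ a • x = T x} :=
    { toFun := fun p => ⟨p.1.2, p.1.1, p.2⟩
      invFun := fun p => ⟨(p.2.1, p.1), p.2.2⟩
      left_inv := fun _ => rfl
      right_inv := fun _ => rfl }
  have e2 : ∀ x : X, Nat.card {a : G // a ∈ g • (H : Set G) ∧ a • x = T x} =
      Nat.card (MulAction.stabilizer H x) := by
    intro x
    obtain ⟨h, hh, e⟩ := hH x (g⁻¹ • T x)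
    refine Nat.card_congr ⟨fun a => ⟨⟨h⁻¹ * (g⁻¹ * a.1), H.mul_mem (H.inv_mem hh) ?_⟩, ?_⟩,
      fun s => ⟨g * (h * s.1.1), ?_, ?_⟩, ?_, ?_⟩
    · have := a.2.1
      rwa [Set.mem_smul_set_iff_inv_smul_mem, smul_eq_mul] at this
    · rw [MulAction.mem_stabilizer_iff]
      change (h⁻¹ * (g⁻¹ * a.1)) • x = x
      rw [mul_smul, mul_smul, a.2.2, ← e, inv_smul_smul]
    · rw [Set.mem_smul_set_iff_inv_smul_mem, smul_eq_mul, inv_mul_cancel_left]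
      exact H.mul_mem hh s.1.2
    · have hs : (s.1.1 : G) • x = x := s.2
      rw [mul_smul, mul_smul, hs, e, smul_inv_smul]
    · intro a; ext; simp
    · intro s; ext; simp
  have e3 : ∀ x : X, Nat.card (MulAction.stabilizer H x) * Nat.card X = Nat.card H := by
    intro x
    rw [← MulAction.index_stabilizer_of_transitive H x, Subgroup.card_mul_index]
  obtain ⟨x0⟩ := ‹Nonempty X›
  have hpos : 0 < Nat.card X := Nat.card_pos
  have e4 : ∀ x : X, Nat.card (MulAction.stabilizer H x) =
      Nat.card (MulAction.stabilizer H x0) := fun x =>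
    Nat.eq_of_mul_eq_mul_right hpos ((e3 x).trans (e3 x0).symm)
  rw [Nat.card_congr e1, Nat.card_sigma, Finset.sum_congr rfl fun x _ => (e2 x).trans (e4 x),
    Finset.sum_const, Finset.card_univ, smul_eq_mul, ← Nat.card_eq_fintype_card, mul_comm, e3]

end GroupCounting

/-! ### Isometric embeddings and the count of equivariant embeddings over a coset -/

section Forms

variable (F : Type*) {K M : Type*} [Field F] [Fintype F] [Field K] [Algebra F K]
  [AddCommGroup M] [Module K M] {n : ℕ}

/-- Sesquilinear forms. -/
abbrev Sesq (F K M : Type*) [Field F] [Fintype F] [Field K] [Algebra F K]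
    [AddCommGroup M] [Module K M] : Type _ := M →ₗ[K] M →ₛₗ[conj F K] K

/-- The pullback of the standard Hermitian form along a linear map. -/
def pullbackForm (f : M →ₗ[K] (Fin n → K)) : Sesq F K M :=
  LinearMap.mk₂'ₛₗ (RingHom.id K) (conj F K) (fun x y => herm F (f x) (f y))
    (fun x y z => by rw [map_add, herm_add_left])
    (fun c x y => by rw [map_smul, herm_smul_left]; rfl)
    (fun x y z => by rw [map_add, herm_add_right])
    (fun c x y => by rw [map_smul, herm_smul_right]; rfl)

theorem pullbackForm_apply (f : M →ₗ[K] (Fin n → K)) (x y : M) :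
    pullbackForm F f x y = herm F (f x) (f y) := rfl

/-- The Hermitian forms on `M` that are invariant under `T`. -/
def invHerm (T : M →ₗ[K] M) : Set (Sesq F K M) :=
  {β | (∀ x y, conj F K (β x y) = β y x) ∧ ∀ x y, β (T x) (T y) = β x y}

/-- The isometric embeddings of `(M, β)` into the standard Hermitian space. -/
def Emb (β : Sesq F K M) (n : ℕ) : Type _ :=
  {f : M →ₗ[K] (Fin n → K) // Function.Injective f ∧ pullbackForm F f = β}

variable {F}

instance (β : Sesq F K M) : MulAction (GU F K n) (Emb F β n) where
  smul A f := ⟨act A ∘ₗ f.1, (act_injective A).comp f.2.1, by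
    refine Eq.trans ?_ f.2.2
    ext x y
    exact herm_act A _ _⟩
  one_smul f := Subtype.ext (by
    change act 1 ∘ₗ f.1 = f.1
    rw [act_one, LinearMap.id_comp])
  mul_smul A B f := Subtype.ext (by
    change act (A * B) ∘ₗ f.1 = act A ∘ₗ (act B ∘ₗ f.1)
    rw [act_mul, LinearMap.comp_assoc])

theorem exists_smul_emb_eq (hK : Module.finrank F K = 2) [Module.Finite K M] {β : Sesq F K M}
    (f g : Emb F β n) : ∃ A : GU F K n, A • f = g := by
  obtain ⟨A, hA⟩ := exists_act_comp_eq (F := F) hK f.1 g.1 f.2.1 g.2.1 fun x y => by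
    rw [← pullbackForm_apply, ← pullbackForm_apply, f.2.2, g.2.2]
  exact ⟨A, Subtype.ext hA⟩

/-- Every Hermitian form of dimension `m` embeds isometrically into `K ^ n` when `2 * m ≤ n`, and
misses a coordinate when `2 * m < n`. -/
theorem exists_emb (hK : Module.finrank F K = 2) [Module.Finite K M] {β : Sesq F K M}
    (hβ : ∀ x y, conj F K (β x y) = β y x) (hn : 2 * Module.finrank K M < n) :
    ∃ f : Emb F β n, ∃ i, ∀ x, f.1 x i = 0 := by
  obtain ⟨m, hm⟩ : ∃ m, m = Module.finrank K M := ⟨_, rfl⟩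
  obtain ⟨r, rfl⟩ : ∃ r, n = m + (m + (r + 1)) := ⟨n - 2 * m - 1, by omega⟩
  have b : Module.Basis (Fin m) K M := Module.finBasisOfFinrankEq K M hm.symm
  obtain ⟨τ, hτ⟩ := exists_add_conj_eq_one hK
  obtain ⟨ε, hε⟩ := exists_mul_conj_eq_neg_one hK
  have hcoord : ∀ x y : M, ∑ i, β x (b i) * conj F K (b.repr y i) = β x y := by
    intro x y
    conv_rhs => rw [← b.sum_repr y, map_sum]
    simp only [LinearMap.map_smulₛₗ, smul_eq_mul, mul_comm]
  -- With `c` the coordinates of `x`, the embedding is `x ↦ (c + L, ε L, 0)`. Since `ε * conj ε =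
  -- -1`, the `L * conj L` terms cancel, leaving `c * conj c`, `c * conj L` and `L * conj c`. With
  -- `L = τ (β(x, b i) - c i)` and `τ + conj τ = 1` these sum to `β`. The zero block has `r + 1`
  -- coordinates, so at least one is spare.
  let L : Fin m → M →ₗ[K] K := fun i =>
    { toFun := fun x => τ * (β x (b i) - b.repr x i)
      map_add' := fun x y => by simp only [map_add, LinearMap.add_apply, Finsupp.add_apply]; ring
      map_smul' := fun c x => by
        simp only [map_smul, LinearMap.smul_apply, Finsupp.smul_apply, smul_eq_mul,
          RingHom.id_apply]
        ring }
  have hL : ∀ x i, L i x = τ * (β x (b i) - b.repr x i) := fun _ _ => rfl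
  let f : M →ₗ[K] (Fin (m + (m + (r + 1))) → K) :=
    LinearMap.pi (Fin.append (fun i => b.coord i + L i) (Fin.append (fun i => ε • L i) 0))
  have hf1 : ∀ x i, f x (Fin.castAdd _ i) = b.repr x i + L i x := fun x i => by simp [f]
  have hf2 : ∀ x i, f x (Fin.natAdd _ (Fin.castAdd _ i)) = ε * L i x := fun x i => by simp [f]
  have hf3 : ∀ x i, f x (Fin.natAdd _ (Fin.natAdd _ i)) = 0 := fun x i => by simp [f]
  refine ⟨⟨f, ?_, ?_⟩, Fin.natAdd _ (Fin.natAdd _ 0), fun x => hf3 x 0⟩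
  · rw [injective_iff_map_eq_zero]
    intro x hx
    have hε0 : ε ≠ 0 := by rintro rfl; simp at hε
    have h2 : ∀ i, L i x = 0 := fun i => by
      have := hf2 x i
      rw [hx] at this
      simpa [hε0] using this
    have h1 : ∀ i, b.repr x i = 0 := fun i => by
      have := hf1 x i
      rw [hx, h2 i] at this
      simpa using this.symm
    exact b.repr.map_eq_zero_iff.1 (Finsupp.ext h1)
  · ext x y
    rw [pullbackForm_apply, herm, Fin.sum_univ_add, Fin.sum_univ_add]
    simp only [hf1, hf2, hf3, zero_mul, Finset.sum_const_zero, add_zero]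
    rw [← Finset.sum_add_distrib]
    have hτ' : conj F K τ = 1 - τ := by linear_combination hτ
    have h1 := hcoord x y
    have h2 : ∑ i, b.repr x i * conj F K (β y (b i)) = β x y := by
      rw [← hβ y x, ← hcoord y x, map_sum]
      simp only [map_mul, conj_conj hK, mul_comm]
    calc _ = ∑ i, (τ * (β x (b i) * conj F K (b.repr y i)) +
          (1 - τ) * (b.repr x i * conj F K (β y (b i)))) := by
            refine Finset.sum_congr rfl fun i _ => ?_
            simp only [hL, map_add, map_mul, map_sub, hτ']
            linear_combination (τ * (β x (b i) - b.repr x i) * (1 - τ) *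
              (conj F K (β y (b i)) - conj F K (b.repr y i))) * hε
      _ = β x y := by
            rw [Finset.sum_add_distrib, ← Finset.mul_sum, ← Finset.mul_sum, h1, h2]; ring

/-- `SU_n(q)` is transitive on embeddings when `n > 2 * dim M`. -/
theorem exists_SU_smul_emb_eq (hK : Module.finrank F K = 2) [Module.Finite K M] {β : Sesq F K M}
    (hβ : ∀ x y, conj F K (β x y) = β y x) (hn : 2 * Module.finrank K M < n)
    (f g : Emb F β n) : ∃ A ∈ SU F K n, A • f = g := by
  classical
  obtain ⟨f0, i0, h0⟩ := exists_emb (n := n) hK hβ hn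
  obtain ⟨A, hA⟩ := exists_smul_emb_eq hK f0 f
  obtain ⟨B, hB⟩ := exists_smul_emb_eq hK f0 g
  let D : GU F K n →* Kˣ :=
    (Matrix.GeneralLinearGroup.det : Matrix.GeneralLinearGroup (Fin n) K →* Kˣ).comp
      (GU F K n).subtype
  have hD : ∀ A : GU F K n, ((D A : Kˣ) : K) * conj F K (D A : Kˣ) = 1 := by
    intro A
    have h := congrArg Matrix.det A.2
    rw [Matrix.det_mul, Matrix.det_transpose, Matrix.det_one] at h
    rw [← h]
    congr 1
    exact RingHom.map_det _ _
  -- A diagonal matrix supported on the coordinate that `f0` misses fixes `f0` and can have any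
  -- determinant of norm one; it corrects the determinant of `B * A⁻¹`.
  obtain ⟨E, hE1, hE2⟩ : ∃ E : GU F K n, D E = D (A * B⁻¹) ∧ E • f0 = f0 := by
    set c := D (A * B⁻¹) with hc
    have hc1 := hD (A * B⁻¹)
    rw [← hc] at hc1
    let d : Fin n → K := fun i => if i = i0 then (c : K) else 1
    have hd : Matrix.diagonal d * ((Matrix.diagonal d).map (conj F K)).transpose = 1 := by
      rw [Matrix.diagonal_map (map_zero _), Matrix.diagonal_transpose, Matrix.diagonal_mul_diagonal,
        ← Matrix.diagonal_one]
      congr 1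
      ext i
      by_cases hi : i = i0
      · simp only [d, hi, if_true]; exact hc1
      · simp only [d, hi, if_false, map_one, mul_one]
    refine ⟨mkGU _ hd, ?_, ?_⟩
    · ext
      change (Matrix.diagonal d).det = _
      rw [Matrix.det_diagonal]
      simp [d]
    · refine Subtype.ext (LinearMap.ext fun x => ?_)
      change (Matrix.diagonal d).mulVec (f0.1 x) = f0.1 x
      ext i
      rw [Matrix.mulVec_diagonal]
      by_cases hi : i = i0
      · rw [hi, h0, mul_zero]
      · simp [d, hi]
  refine ⟨B * E * A⁻¹, ?_, ?_⟩
  · change D (B * E * A⁻¹) = 1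
    rw [map_mul, map_mul, hE1, map_mul, map_inv, map_inv, mul_comm (D A),
      mul_inv_cancel_left, mul_inv_cancel]
  · rw [mul_smul, ← hA, inv_smul_smul, mul_smul, hE2, hB]

/-- The set of `T`-equivariant embeddings, where `A` acts on `K ^ n`. -/
def equivEmb (T : M →ₗ[K] M) (A : (Fin n → K) →ₗ[K] (Fin n → K)) :
    Set (M →ₗ[K] (Fin n → K)) :=
  {f | Function.Injective f ∧ f ∘ₗ T = A ∘ₗ f}

/-- Pairs are sorted by the form `β` that `f` pulls back, which is `T`-invariant because `A` is an
isometry. Inside one class `f ∘ T` is again an isometric embedding of `(M, β)` and equivariance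
reads `A • f = f ∘ T`, so `card_coset_smul_eq` counts each nonempty class as `|H|`. -/
theorem card_equivEmb_pairs (hK : Module.finrank F K = 2) [Module.Finite K M] (T : M →ₗ[K] M)
    (hT : Function.Injective T) (H : Subgroup (GU F K n)) (g : GU F K n)
    (htrans : ∀ β ∈ invHerm F T, ∀ f g : Emb F β n, ∃ A ∈ H, A • f = g) :
    Nat.card {p : GU F K n × (M →ₗ[K] (Fin n → K)) //
      p.1 ∈ g • (H : Set (GU F K n)) ∧ p.2 ∈ equivEmb T (act p.1)} =
    {β ∈ invHerm F T | Nonempty (Emb F β n)}.ncard * Nat.card H := by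
  classical
  have := finite_of_finrank_eq_two hK
  have : Finite M := Module.finite_of_finite K
  have : Finite (M →ₛₗ[conj F K] K) := DFunLike.finite _
  have : Finite (M →ₗ[K] (Fin n → K)) := DFunLike.finite _
  have : Finite (Sesq F K M) := DFunLike.finite _
  have : ∀ β : Sesq F K M, Finite (Emb F β n) := fun β => Subtype.finite
  let J := {β : Sesq F K M // β ∈ {β ∈ invHerm F T | Nonempty (Emb F β n)}}
  have : Fintype J := Fintype.ofFinite J
  let S : ∀ β : J, Emb F β.1 n → Emb F β.1 n := fun β e => ⟨e.1 ∘ₗ T, e.2.1.comp hT, by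
    ext x y
    change herm F (e.1 (T x)) (e.1 (T y)) = _
    rw [← pullbackForm_apply, e.2.2, β.2.1.2]⟩
  have e1 : {p : GU F K n × (M →ₗ[K] (Fin n → K)) //
      p.1 ∈ g • (H : Set (GU F K n)) ∧ p.2 ∈ equivEmb T (act p.1)} ≃
      Σ β : J, {p : GU F K n × Emb F β.1 n //
        p.1 ∈ g • (H : Set (GU F K n)) ∧ p.1 • p.2 = S β p.2} :=
    { toFun := fun p => ⟨⟨pullbackForm F p.1.2, ⟨fun x y => conj_herm hK _ _, fun x y => by
            have h := LinearMap.congr_fun p.2.2.2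
            simp only [LinearMap.comp_apply] at h
            rw [pullbackForm_apply, h, h, herm_act, pullbackForm_apply]⟩,
            ⟨⟨p.1.2, p.2.2.1, rfl⟩⟩⟩,
          ⟨(p.1.1, ⟨p.1.2, p.2.2.1, rfl⟩), p.2.1, Subtype.ext p.2.2.2.symm⟩⟩
      invFun := fun p => ⟨(p.2.1.1, p.2.1.2.1), p.2.2.1, p.2.1.2.2.1,
        (congrArg Subtype.val p.2.2.2).symm⟩
      left_inv := fun _ => rfl
      right_inv := by
        rintro ⟨⟨β, hβ⟩, ⟨⟨A, e⟩, h⟩⟩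
        revert h
        obtain ⟨f, hf, hfβ⟩ := e
        have h3 : pullbackForm F f = β := hfβ
        subst h3
        intro h
        rfl }
  have e2 : ∀ β : J, Nat.card {p : GU F K n × Emb F β.1 n //
      p.1 ∈ g • (H : Set (GU F K n)) ∧ p.1 • p.2 = S β p.2} = Nat.card H := fun β =>
    have := β.2.2
    card_coset_smul_eq H (htrans β.1 β.2.1) g (S β)
  rw [Nat.card_congr e1, Nat.card_sigma, Finset.sum_congr rfl fun β _ => e2 β, Finset.sum_const,
    Finset.card_univ, smul_eq_mul, ← Nat.card_eq_fintype_card]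
  rfl

/-- The total number of equivariant embeddings over a coset of `SU_n(q)`, for large `n`. -/
theorem card_equivEmb_pairs_SU (hK : Module.finrank F K = 2) [Module.Finite K M] (T : M →ₗ[K] M)
    (hT : Function.Injective T) (g : GU F K n) (hn : 2 * Module.finrank K M < n) :
    Nat.card {p : GU F K n × (M →ₗ[K] (Fin n → K)) //
      p.1 ∈ g • (SU F K n : Set (GU F K n)) ∧ p.2 ∈ equivEmb T (act p.1)} =
    (invHerm F T).ncard * Nat.card (SU F K n) := by
  rw [card_equivEmb_pairs hK T hT (SU F K n) g fun β hβ f g =>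
    exists_SU_smul_emb_eq hK hβ.1 hn f g]
  congr 2
  ext β
  exact ⟨fun h => h.1, fun h => ⟨h, (exists_emb hK h.1 hn).nonempty⟩⟩

/-- The bound, uniform in `n`, needed for dominated convergence. For small `n` transitivity of
`SU_n` is not available, so the coset is enlarged to all of `GU_n`, where Witt's theorem needs no
condition on `n`; the cost is the index of `SU_n`, at most `|Kˣ|`. -/
theorem card_equivEmb_pairs_le (hK : Module.finrank F K = 2) [Module.Finite K M] (T : M →ₗ[K] M)
    (hT : Function.Injective T) (g : GU F K n) :
    Nat.card {p : GU F K n × (M →ₗ[K] (Fin n → K)) //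
      p.1 ∈ g • (SU F K n : Set (GU F K n)) ∧ p.2 ∈ equivEmb T (act p.1)} ≤
    (invHerm F T).ncard * (Nat.card Kˣ * Nat.card (SU F K n)) := by
  have := finite_of_finrank_eq_two hK
  have : Finite M := Module.finite_of_finite K
  have : Finite (M →ₛₗ[conj F K] K) := DFunLike.finite _
  have : Finite (M →ₗ[K] (Fin n → K)) := DFunLike.finite _
  have : Finite (Sesq F K M) := DFunLike.finite _
  have h1 := card_equivEmb_pairs hK T hT (⊤ : Subgroup (GU F K n)) 1 fun β hβ f g => by
    obtain ⟨A, hA⟩ := exists_smul_emb_eq hK f g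
    exact ⟨A, Subgroup.mem_top A, hA⟩
  refine (Nat.card_le_card_of_injective
    (β := {p : GU F K n × (M →ₗ[K] (Fin n → K)) //
      p.1 ∈ (1 : GU F K n) • ((⊤ : Subgroup (GU F K n)) : Set (GU F K n)) ∧
        p.2 ∈ equivEmb T (act p.1)})
    (fun p => ⟨p.1, by simp, p.2.2⟩)
    (fun p p' h => by
      have h' := congrArg Subtype.val h
      exact Subtype.ext h')).trans (h1.le.trans ?_)
  refine Nat.mul_le_mul (Set.ncard_le_ncard (fun β h => h.1) (Set.toFinite _)) ?_
  rw [Subgroup.card_top, ← Subgroup.card_mul_index (SU F K n), mul_comm]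
  refine Nat.mul_le_mul_right _ ?_
  rw [SU, Subgroup.index_ker]
  exact Subgroup.card_le_card_group _

end Forms

/-! ### The kernel of `f(D)` as a module over `K[X]/(f)` -/

section KerAeval

variable {K N : Type*} [Field K] [AddCommGroup N] [Module K N]

/-- The kernel of `f(D)`. -/
abbrev kerAeval (D : Module.End K N) (f : K[X]) : Submodule K N := LinearMap.ker (aeval D f)

theorem aeval_mem_kerAeval (D : Module.End K N) (f p : K[X]) {v : N} (hv : v ∈ kerAeval D f) :
    aeval D p v ∈ kerAeval D f := by
  rw [LinearMap.mem_ker] at hv ⊢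
  rw [← Module.End.mul_apply, ← map_mul, mul_comm, map_mul, Module.End.mul_apply, hv, map_zero]

/-- `K[X] / (f)` acts on the kernel of `f(D)`. -/
def kerAevalHom (D : Module.End K N) (f : K[X]) : AdjoinRoot f →+* Module.End K (kerAeval D f) :=
  Ideal.Quotient.lift _
    ({ toFun := fun p => (aeval D p).restrict fun _ hv => aeval_mem_kerAeval D f p hv
       map_one' := by ext; simp
       map_mul' := fun p q => by ext; simp
       map_zero' := by ext; simp
       map_add' := fun p q => by ext; simp } : K[X] →+* Module.End K (kerAeval D f))
    (by
      intro p hp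
      obtain ⟨r, rfl⟩ := Ideal.mem_span_singleton'.1 hp
      ext ⟨v, hv⟩
      change aeval D (r * f) v = 0
      rw [map_mul, Module.End.mul_apply, LinearMap.mem_ker.1 hv, map_zero])

instance (D : Module.End K N) (f : K[X]) : Module (AdjoinRoot f) (kerAeval D f) :=
  Module.compHom _ (kerAevalHom D f)

theorem mk_smul_kerAeval (D : Module.End K N) (f p : K[X]) (v : kerAeval D f) :
    ((AdjoinRoot.mk f p • v : kerAeval D f) : N) = aeval D p v := rfl

instance (D : Module.End K N) (f : K[X]) : IsScalarTower K (AdjoinRoot f) (kerAeval D f) where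
  smul_assoc c x v := by
    obtain ⟨p, rfl⟩ := AdjoinRoot.mk_surjective x
    rw [AdjoinRoot.smul_mk]
    ext
    rw [mk_smul_kerAeval, Submodule.coe_smul, mk_smul_kerAeval, map_smul, LinearMap.smul_apply]

theorem comp_aeval_eq {M : Type*} [AddCommGroup M] [Module K M] {T : Module.End K M}
    {D : Module.End K N} {g : M →ₗ[K] N} (h : g ∘ₗ T = D ∘ₗ g) (p : K[X]) (x : M) :
    g (aeval T p x) = aeval D p (g x) := by
  induction p using Polynomial.induction_on' with
  | add p q hp hq => simp [hp, hq]
  | monomial n a =>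
    rw [aeval_monomial, aeval_monomial, Module.End.mul_apply, Module.End.mul_apply,
      Module.algebraMap_end_apply, Module.algebraMap_end_apply, map_smul]
    congr 1
    induction n with
    | zero => simp
    | succ n ih =>
      rw [pow_succ', pow_succ', Module.End.mul_apply, Module.End.mul_apply, ← ih]
      exact LinearMap.congr_fun h _

theorem natCard_adjoinRoot [Finite K] {f : K[X]} (hf : f ≠ 0) :
    Nat.card (AdjoinRoot f) = Nat.card K ^ f.natDegree := by
  have := (AdjoinRoot.powerBasis hf).finite
  rw [Module.natCard_eq_pow_finrank (K := K), (AdjoinRoot.powerBasis hf).finrank,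
    AdjoinRoot.powerBasis_dim]

end KerAeval

/-! ### Equivariant maps out of a sum of cyclic modules -/

section CyclicSum

variable {K : Type*} [Field K] {ι : Type*} (φ : ι → K[X]) (k : ι → ℕ)

/-- The `K[X]`-module `⨁ s, (K[X] / (φ s)) ^ (k s)`. -/
abbrev CyclicSum : Type _ := (s : ι) → Fin (k s) → AdjoinRoot (φ s)

/-- Multiplication by the variable. -/
def mulRoot : Module.End K (CyclicSum φ k) where
  toFun x s i := AdjoinRoot.root (φ s) * x s i
  map_add' x y := by ext s i; simp [mul_add]
  map_smul' c x := by ext s i; simp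

variable {φ k}

theorem aeval_mulRoot (p : K[X]) (x : CyclicSum φ k) (s : ι) (i : Fin (k s)) :
    aeval (mulRoot φ k) p x s i = AdjoinRoot.mk (φ s) p * x s i := by
  induction p using Polynomial.induction_on' with
  | add p q hp hq => simp [hp, hq, add_mul]
  | monomial n a =>
    rw [aeval_monomial, Module.End.mul_apply, Module.algebraMap_end_apply, ← C_mul_X_pow_eq_monomial,
      map_mul, map_pow, AdjoinRoot.mk_C, AdjoinRoot.mk_X, mul_assoc, Pi.smul_apply, Pi.smul_apply,
      Algebra.smul_def]
    congr 1
    induction n with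
    | zero => simp
    | succ n ih =>
      rw [pow_succ', pow_succ', Module.End.mul_apply, mul_assoc, ← ih]
      rfl

variable {N : Type*} [AddCommGroup N] [Module K N] (D : Module.End K N)

variable [Fintype ι] [DecidableEq ι]

/-- Equivariant maps out of a sum of cyclic modules are given by tuples in the kernels. -/
def equivariantEquiv : {g : CyclicSum φ k →ₗ[K] N // g ∘ₗ mulRoot φ k = D ∘ₗ g} ≃
    ((s : ι) → Fin (k s) → kerAeval D (φ s)) where
  toFun g s i := ⟨g.1 (Pi.single s (Pi.single i 1)), by
    rw [LinearMap.mem_ker, ← comp_aeval_eq g.2]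
    convert map_zero g.1
    ext s' i'
    rw [aeval_mulRoot]
    by_cases hs : s' = s
    · subst hs; simp
    · simp [Pi.single_eq_of_ne hs]⟩
  invFun v := ⟨∑ s, ∑ i, (kerAeval D (φ s)).subtype ∘ₗ
      (LinearMap.toSpanSingleton (AdjoinRoot (φ s)) _ (v s i)).restrictScalars K ∘ₗ
        LinearMap.proj i ∘ₗ LinearMap.proj s, by
    refine LinearMap.ext fun x => ?_
    simp only [LinearMap.comp_apply, LinearMap.sum_apply, map_sum]
    refine Finset.sum_congr rfl fun s _ => Finset.sum_congr rfl fun i _ => ?_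
    change (((AdjoinRoot.root (φ s) * x s i) • v s i : kerAeval D (φ s)) : N) =
      D ((x s i • v s i : kerAeval D (φ s)) : N)
    rw [mul_smul, ← AdjoinRoot.mk_X, mk_smul_kerAeval, aeval_X]⟩
  left_inv g := by
    refine Subtype.ext (LinearMap.ext fun x => ?_)
    simp only [LinearMap.sum_apply]
    have hx : x = ∑ s, ∑ i, Pi.single s (Pi.single i (x s i)) := by
      ext s i
      simp only [Finset.sum_apply]
      rw [Finset.sum_eq_single s, Finset.sum_eq_single i]
      · simp
      · intro i' _ hi
        simp [hi.symm]
      · simp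
      · intro s' _ hs
        exact Finset.sum_eq_zero fun i' _ => by rw [Pi.single_eq_of_ne hs.symm]; rfl
      · simp
    conv_rhs => rw [hx, map_sum]
    refine Finset.sum_congr rfl fun s _ => ?_
    rw [map_sum]
    refine Finset.sum_congr rfl fun i _ => ?_
    obtain ⟨p, hp⟩ := AdjoinRoot.mk_surjective (x s i)
    change ((x s i • (⟨g.1 (Pi.single s (Pi.single i 1)), _⟩ : kerAeval D (φ s)) :
      kerAeval D (φ s)) : N) = _
    rw [← hp, mk_smul_kerAeval, ← comp_aeval_eq g.2]
    congr 1
    ext s' i'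
    rw [aeval_mulRoot]
    by_cases hs : s' = s
    · subst hs
      by_cases hi : i' = i
      · subst hi; simp
      · simp [hi]
    · simp [Pi.single_eq_of_ne hs]
  right_inv v := by
    ext s i
    simp only [LinearMap.sum_apply]
    rw [Finset.sum_eq_single s, Finset.sum_eq_single i]
    · change (((Pi.single s (Pi.single i 1) : CyclicSum φ k) s i • v s i :
        kerAeval D (φ s)) : N) = _
      simp
    · intro i' _ hi
      change (((Pi.single s (Pi.single i 1) : CyclicSum φ k) s i' • v s i' :
        kerAeval D (φ s)) : N) = _
      simp [hi]
    · simp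
    · intro s' _ hs
      refine Finset.sum_eq_zero fun i' _ => ?_
      change (((Pi.single s (Pi.single i 1) : CyclicSum φ k) s' i' • v s' i' :
        kerAeval D (φ s')) : N) = _
      simp [hs]
    · simp

theorem equivariantEquiv_symm_apply (v : (s : ι) → Fin (k s) → kerAeval D (φ s))
    (x : CyclicSum φ k) : ((equivariantEquiv D).symm v).1 x =
      ∑ s, ((∑ i, x s i • v s i : kerAeval D (φ s)) : N) := by
  change (∑ s, ∑ i, (kerAeval D (φ s)).subtype ∘ₗ
      (LinearMap.toSpanSingleton (AdjoinRoot (φ s)) _ (v s i)).restrictScalars K ∘ₗ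
        LinearMap.proj i ∘ₗ LinearMap.proj s) x = _
  simp only [LinearMap.sum_apply]
  refine Finset.sum_congr rfl fun s _ => ?_
  rw [AddSubmonoidClass.coe_finsetSum]
  rfl

theorem eq_zero_of_sum_kerAeval (hφ : Pairwise fun s s' => IsCoprime (φ s) (φ s'))
    (y : (s : ι) → kerAeval D (φ s)) (hy : ∑ s, (y s : N) = 0) (s : ι) : y s = 0 := by
  have hco : IsCoprime (φ s) (∏ r ∈ Finset.univ.erase s, φ r) :=
    IsCoprime.prod_right fun r hr => hφ (Finset.ne_of_mem_erase hr).symm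
  have h1 : aeval D (∏ r ∈ Finset.univ.erase s, φ r) (y s : N) = 0 := by
    have h2 := congrArg (aeval D (∏ r ∈ Finset.univ.erase s, φ r)) hy
    rw [map_sum, map_zero, Finset.sum_eq_single s] at h2
    · exact h2
    · intro r _ hr
      rw [← Finset.prod_erase_mul _ _ (Finset.mem_erase.2 ⟨hr, Finset.mem_univ r⟩), map_mul,
        Module.End.mul_apply, LinearMap.mem_ker.1 (y r).2, map_zero]
    · simp
  have h3 := Polynomial.disjoint_ker_aeval_of_isCoprime D hco
  exact Subtype.ext (Submodule.disjoint_def.1 h3 _ (y s).2 h1)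

/-- Kernels of pairwise coprime polynomials in `D` are independent, so injectivity can be tested on
one `φ s` at a time. -/
theorem equivariantEquiv_symm_injective_iff (hφ : Pairwise fun s s' => IsCoprime (φ s) (φ s'))
    (v : (s : ι) → Fin (k s) → kerAeval D (φ s)) :
    Function.Injective ((equivariantEquiv D).symm v).1 ↔
      ∀ s, LinearIndependent (AdjoinRoot (φ s)) (v s) := by
  rw [injective_iff_map_eq_zero]
  constructor
  · intro h s
    rw [Fintype.linearIndependent_iff]
    intro c hc
    have := h (Pi.single s c) (by
      rw [equivariantEquiv_symm_apply]
      refine Finset.sum_eq_zero fun r _ => ?_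
      by_cases hr : r = s
      · subst hr; simp [hc]
      · simp [Pi.single_eq_of_ne hr])
    intro i
    have := congrFun (congrFun this s) i
    simpa using this
  · intro h x hx
    rw [equivariantEquiv_symm_apply] at hx
    ext s i
    exact Fintype.linearIndependent_iff.1 (h s) (x s) (eq_zero_of_sum_kerAeval D hφ _ hx s) i

/-- Stated in `ℝ` so that the formula also holds for `k` above the dimension, where the factor with
`i` equal to the dimension vanishes. -/
theorem card_linearIndependent_eq {L U : Type*} [Field L] [Finite L] [AddCommGroup U] [Module L U]
    [Finite U] (k : ℕ) : (Nat.card {v : Fin k → U // LinearIndependent L v} : ℝ) =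
      ∏ i ∈ Finset.range k, ((Nat.card L : ℝ) ^ Module.finrank L U - (Nat.card L : ℝ) ^ i) := by
  have := Fintype.ofFinite L
  by_cases hk : k ≤ Module.finrank L U
  · rw [card_linearIndependent hk, Nat.cast_prod, Finset.prod_range]
    refine Finset.prod_congr rfl fun i _ => ?_
    rw [Nat.cast_sub (Nat.pow_le_pow_right Fintype.card_pos (i.2.le.trans hk)),
      Nat.card_eq_fintype_card]
    push_cast
    rfl
  · rw [Finset.prod_eq_zero (Finset.mem_range.2 (not_le.1 hk)) (sub_self _), Nat.cast_eq_zero,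
      Nat.card_eq_zero]
    refine Or.inl ⟨fun v => hk ?_⟩
    have := Module.Finite.of_finite (R := L) (M := U)
    simpa using v.2.fintype_card_le_finrank

/-- The number of equivariant embeddings of a sum of simple cyclic modules. -/
theorem card_equivEmb [Finite K] {n : ℕ} (D : Module.End K (Fin n → K))
    (hφ : Pairwise fun s s' => IsCoprime (φ s) (φ s')) [∀ s, Fact (Irreducible (φ s))] :
    (Nat.card (equivEmb (mulRoot φ k) D) : ℝ) = ∏ s, ∏ i ∈ Finset.range (k s),
      (((Nat.card K : ℝ) ^ (φ s).natDegree) ^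
          Module.finrank (AdjoinRoot (φ s)) (kerAeval D (φ s)) -
        ((Nat.card K : ℝ) ^ (φ s).natDegree) ^ i) := by
  have e : equivEmb (mulRoot φ k) D ≃
      ((s : ι) → {v : Fin (k s) → kerAeval D (φ s) // LinearIndependent (AdjoinRoot (φ s)) v}) :=
    calc (equivEmb (mulRoot φ k) D : Type _)
      _ ≃ {g : {g : CyclicSum φ k →ₗ[K] (Fin n → K) // g ∘ₗ mulRoot φ k = D ∘ₗ g} //
            Function.Injective g.1} :=
          { toFun := fun g => ⟨⟨g.1, g.2.2⟩, g.2.1⟩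
            invFun := fun g => ⟨g.1.1, g.2, g.1.2⟩
            left_inv := fun _ => rfl
            right_inv := fun _ => rfl }
      _ ≃ {v : (s : ι) → Fin (k s) → kerAeval D (φ s) //
            ∀ s, LinearIndependent (AdjoinRoot (φ s)) (v s)} :=
          (equivariantEquiv D).subtypeEquiv fun g => by
            rw [← equivariantEquiv_symm_injective_iff D hφ, Equiv.symm_apply_apply]
      _ ≃ _ := Equiv.subtypePiEquivPi
        (p := fun s (v : Fin (k s) → kerAeval D (φ s)) => LinearIndependent (AdjoinRoot (φ s)) v)
  rw [Nat.card_congr e, Nat.card_pi, Nat.cast_prod]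
  refine Finset.prod_congr rfl fun s _ => ?_
  have h0 : φ s ≠ 0 := (Fact.out : Irreducible (φ s)).ne_zero
  have := (AdjoinRoot.powerBasis h0).finite
  have : Finite (AdjoinRoot (φ s)) := Module.finite_of_finite K
  rw [card_linearIndependent_eq, natCard_adjoinRoot h0]
  push_cast
  rfl

end CyclicSum

/-! ### Hermitian forms against sesquilinear forms -/

section HermitianCount

variable {F K M : Type*} [Field F] [Fintype F] [Field K] [Algebra F K]
  [AddCommGroup M] [Module K M]

theorem natCard_semilinear (hK : Module.finrank F K = 2) [Module.Finite K M] :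
    Nat.card (M →ₛₗ[conj F K] K) = Nat.card K ^ Module.finrank K M := by
  have := finite_of_finrank_eq_two hK
  have e : (M →ₛₗ[conj F K] K) ≃ Module.Dual K M :=
    { toFun := fun l =>
        { toFun := fun x => conj F K (l x)
          map_add' := fun x y => by rw [map_add, map_add]
          map_smul' := fun c x => by
            rw [LinearMap.map_smulₛₗ, smul_eq_mul, map_mul, conj_conj hK]; rfl }
      invFun := fun l =>
        { toFun := fun x => conj F K (l x)
          map_add' := fun x y => by rw [map_add, map_add]
          map_smul' := fun c x => by rw [map_smul, smul_eq_mul, map_mul]; rfl }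
      left_inv := fun l => by ext x; exact conj_conj hK _
      right_inv := fun l => by ext x; exact conj_conj hK _ }
  rw [Nat.card_congr e, Module.natCard_eq_pow_finrank (K := K), Subspace.dual_finrank_eq]

variable (F) in
/-- The sesquilinear forms on `M` that are invariant under `T`. -/
def invSesq (T : M →ₗ[K] M) : Set (Sesq F K M) := {β | ∀ x y, β (T x) (T y) = β x y}

/-- The conjugate transpose of a sesquilinear form. -/
def adj (hK : Module.finrank F K = 2) (β : Sesq F K M) : Sesq F K M :=
  LinearMap.mk₂'ₛₗ (RingHom.id K) (conj F K) (fun x y => conj F K (β y x))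
    (fun x y z => by rw [map_add, map_add])
    (fun c x y => by rw [LinearMap.map_smulₛₗ, smul_eq_mul, map_mul, conj_conj hK]; rfl)
    (fun x y z => by rw [map_add, LinearMap.add_apply, map_add])
    (fun c x y => by rw [map_smul, LinearMap.smul_apply, smul_eq_mul, map_mul]; rfl)

theorem adj_apply (hK : Module.finrank F K = 2) (β : Sesq F K M) (x y : M) :
    adj hK β x y = conj F K (β y x) := rfl

/-- An invariant sesquilinear form is uniquely `a + θ b` with `a`, `b` invariant Hermitian. -/
theorem ncard_invHerm_sq (hK : Module.finrank F K = 2) (T : M →ₗ[K] M) :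
    (invHerm F T).ncard ^ 2 = (invSesq F T).ncard := by
  obtain ⟨θ, hθ⟩ := exists_conj_ne hK
  have hθ' : θ - conj F K θ ≠ 0 := sub_ne_zero.2 hθ.symm
  let e : invHerm F T × invHerm F T ≃ invSesq F T :=
    { toFun := fun p => ⟨p.1.1 + θ • p.2.1, fun x y => by
        simp only [LinearMap.add_apply, LinearMap.smul_apply, p.1.2.2, p.2.2.2]⟩
      -- The conjugate transpose of `a + θ b` is `a + conj θ b`; the two equations are solved for
      -- `b`, then `a`.
      invFun := fun β =>
        (⟨β.1 - θ • ((θ - conj F K θ)⁻¹ • (β.1 - adj hK β.1)), fun x y => by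
            simp only [LinearMap.sub_apply, LinearMap.smul_apply, adj_apply, smul_eq_mul, map_sub,
              map_mul, map_inv₀, conj_conj hK]
            have h2 : conj F K θ - θ ≠ 0 := sub_ne_zero.2 hθ
            field_simp
            ring, fun x y => by
            simp only [LinearMap.sub_apply, LinearMap.smul_apply, adj_apply, β.2 x y, β.2 y x]⟩,
          ⟨(θ - conj F K θ)⁻¹ • (β.1 - adj hK β.1), fun x y => by
            simp only [LinearMap.sub_apply, LinearMap.smul_apply, adj_apply, smul_eq_mul, map_sub,
              map_mul, map_inv₀, conj_conj hK]
            have h2 : conj F K θ - θ ≠ 0 := sub_ne_zero.2 hθ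
            field_simp
            ring, fun x y => by
            simp only [LinearMap.sub_apply, LinearMap.smul_apply, adj_apply, β.2 x y, β.2 y x]⟩)
      left_inv := by
        rintro ⟨⟨a, ha⟩, ⟨b, hb⟩⟩
        have h : (θ - conj F K θ)⁻¹ • (a + θ • b - adj hK (a + θ • b)) = b := by
          ext x y
          simp only [LinearMap.sub_apply, LinearMap.add_apply, LinearMap.smul_apply, adj_apply,
            smul_eq_mul, map_add, map_mul, ha.1 y x, hb.1 y x]
          field_simp
          ring
        refine Prod.ext (Subtype.ext ?_) (Subtype.ext h)
        change a + θ • b - θ • ((θ - conj F K θ)⁻¹ • (a + θ • b - adj hK (a + θ • b))) = a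
        rw [h]
        ext x y
        exact add_sub_cancel_right _ _
      right_inv := fun β => by
        refine Subtype.ext (LinearMap.ext fun x => LinearMap.ext fun y => ?_)
        exact sub_add_cancel _ _ }
  rw [pow_two, Set.ncard_def, Set.ncard_def]
  exact (Nat.card_prod _ _).symm.trans (Nat.card_congr e)

end HermitianCount

/-! ### Counting invariant forms on a sum of cyclic modules -/

section CyclicForms

variable {F K : Type*} [Field F] [Fintype F] [Field K] [Algebra F K]
  {ι : Type*} {φ : ι → K[X]} {k : ι → ℕ}

theorem root_ne_zero {g : K[X]} [Fact (Irreducible g)] (hg : g.coeff 0 ≠ 0) :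
    AdjoinRoot.root g ≠ 0 := by
  intro h
  rw [← AdjoinRoot.mk_X, AdjoinRoot.mk_eq_zero] at h
  exact hg (X_dvd_iff.1
    ((Fact.out : Irreducible g).associated_of_dvd irreducible_X h).symm.dvd)

/-- Reversal inverts roots, and the constant in `tildeConj` is nonzero. -/
theorem aeval_root_tildeConj_eq_zero_iff {f g : K[X]} [Fact (Irreducible g)] (hf : f.coeff 0 ≠ 0)
    (hg : g.coeff 0 ≠ 0) :
    aeval (AdjoinRoot.root g)⁻¹ (f.map (conj F K)) = 0 ↔
      aeval (AdjoinRoot.root g) (tildeConj F K f) = 0 := by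
  have hr := root_ne_zero hg
  let _ := invertibleOfNonzero (inv_ne_zero hr)
  have h := eval₂_reverse_eq_zero_iff (algebraMap K (AdjoinRoot g)) (AdjoinRoot.root g)⁻¹
    (f.map (conj F K))
  rw [invOf_eq_inv, inv_inv] at h
  rw [aeval_def, ← h, tildeConj, map_mul, aeval_C, mul_eq_zero, aeval_def, or_iff_right]
  simpa using hf

variable [∀ s, Fact (Irreducible (φ s))]

variable (φ k) in
/-- Division by the variable. -/
def divRoot : Module.End K (CyclicSum φ k) where
  toFun x s i := (AdjoinRoot.root (φ s))⁻¹ * x s i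
  map_add' x y := by ext s i; simp [mul_add]
  map_smul' c x := by ext s i; simp

theorem mulRoot_divRoot (h0 : ∀ s, (φ s).coeff 0 ≠ 0) (x : CyclicSum φ k) :
    mulRoot φ k (divRoot φ k x) = x := by
  ext s i
  exact mul_inv_cancel_left₀ (root_ne_zero (h0 s)) _

theorem divRoot_mulRoot (h0 : ∀ s, (φ s).coeff 0 ≠ 0) (x : CyclicSum φ k) :
    divRoot φ k (mulRoot φ k x) = x := by
  ext s i
  exact inv_mul_cancel_left₀ (root_ne_zero (h0 s)) _

theorem aeval_divRoot (p : K[X]) (x : CyclicSum φ k) (s : ι) (i : Fin (k s)) :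
    aeval (divRoot φ k) p x s i = aeval (AdjoinRoot.root (φ s))⁻¹ p * x s i := by
  induction p using Polynomial.induction_on' with
  | add p q hp hq => simp [hp, hq, add_mul]
  | monomial n a =>
    rw [aeval_monomial, Module.End.mul_apply, Module.algebraMap_end_apply, aeval_monomial,
      mul_assoc, Pi.smul_apply, Pi.smul_apply, Algebra.smul_def]
    congr 1
    induction n with
    | zero => simp
    | succ n ih =>
      rw [pow_succ', pow_succ', Module.End.mul_apply, mul_assoc, ← ih]
      rfl

variable (F φ k) in
/-- The operator on conjugate-linear functionals adjoint to division by the variable. -/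
def dualDivRoot : Module.End K (CyclicSum φ k →ₛₗ[conj F K] K) where
  toFun l := l.comp (divRoot φ k)
  map_add' _ _ := rfl
  map_smul' _ _ := rfl

theorem aeval_dualDivRoot (hK : Module.finrank F K = 2) (p : K[X])
    (l : CyclicSum φ k →ₛₗ[conj F K] K) (x : CyclicSum φ k) :
    aeval (dualDivRoot F φ k) p l x = l (aeval (divRoot φ k) (p.map (conj F K)) x) := by
  induction p using Polynomial.induction_on' with
  | add p q hp hq =>
    rw [map_add, LinearMap.add_apply, LinearMap.add_apply, hp, hq, Polynomial.map_add, map_add,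
      LinearMap.add_apply, map_add]
  | monomial n a =>
    rw [map_monomial, aeval_monomial, aeval_monomial, Module.End.mul_apply, Module.End.mul_apply,
      Module.algebraMap_end_apply, Module.algebraMap_end_apply, LinearMap.map_smulₛₗ, conj_conj hK,
      LinearMap.smul_apply]
    congr 1
    induction n generalizing x with
    | zero => simp
    | succ n ih =>
      rw [pow_succ', pow_succ, Module.End.mul_apply, Module.End.mul_apply, ← ih]
      rfl

theorem finite_adjoinRoot (s : ι) : Module.Finite K (AdjoinRoot (φ s)) :=
  (AdjoinRoot.powerBasis (Fact.out : Irreducible (φ s)).ne_zero).finite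

variable [DecidableEq ι]

/-- On the component of `φ s` the relevant operator multiplies by `(φ r)^σ (root⁻¹)`, which is zero
if `φ s` is the conjugate of `φ r` and invertible otherwise. The kernel is thus the conjugate dual
of the single component `r'`. -/
theorem natCard_kerAeval_dualDivRoot (hK : Module.finrank F K = 2)
    (h0 : ∀ s, (φ s).coeff 0 ≠ 0) (hm : ∀ s, (φ s).Monic) (hφ : Function.Injective φ) (r r' : ι)
    (hr : φ r' = tildeConj F K (φ r)) :
    Nat.card (kerAeval (dualDivRoot F φ k) (φ r)) = Nat.card K ^ (k r' * (φ r').natDegree) := by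
  have hz : ∀ s, aeval (AdjoinRoot.root (φ s))⁻¹ ((φ r).map (conj F K)) = 0 ↔ s = r' := by
    intro s
    rw [aeval_root_tildeConj_eq_zero_iff (h0 r) (h0 s), ← hr, AdjoinRoot.aeval_eq,
      AdjoinRoot.mk_eq_zero]
    constructor
    · intro h
      exact hφ (eq_of_monic_of_associated (hm s) (hm r')
        ((Fact.out : Irreducible (φ s)).associated_of_dvd Fact.out h))
    · rintro rfl; exact dvd_rfl
  let e : kerAeval (dualDivRoot F φ k) (φ r) ≃ ((Fin (k r') → AdjoinRoot (φ r')) →ₛₗ[conj F K] K) :=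
    { toFun := fun l => l.1.comp (LinearMap.single K (fun s => Fin (k s) → AdjoinRoot (φ s)) r')
      invFun := fun m => ⟨m.comp (LinearMap.proj r' : CyclicSum φ k →ₗ[K] _), by
        rw [LinearMap.mem_ker]
        ext1 x
        rw [aeval_dualDivRoot hK]
        change m (aeval (divRoot φ k) ((φ r).map (conj F K)) x r') = 0
        convert map_zero m
        ext i
        rw [aeval_divRoot, (hz r').2 rfl, zero_mul]
        rfl⟩
      left_inv := by
        rintro ⟨l, hl⟩
        refine Subtype.ext (LinearMap.ext fun x => ?_)
        change l (Pi.single r' (x r')) = l x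
        rw [eq_comm, ← sub_eq_zero, ← map_sub]
        -- A preimage of `x` with its `r'` component removed. At `s = r'` the inverse is `0⁻¹ = 0`,
        -- harmlessly, as the operator vanishes there.
        let y : CyclicSum φ k := fun s i =>
          (aeval (AdjoinRoot.root (φ s))⁻¹ ((φ r).map (conj F K)))⁻¹ * x s i
        have hy : aeval (divRoot φ k) ((φ r).map (conj F K)) y = x - Pi.single r' (x r') := by
          ext s i
          rw [aeval_divRoot, Pi.sub_apply, Pi.sub_apply]
          by_cases hs : s = r'
          · subst hs
            rw [(hz s).2 rfl, zero_mul, Pi.single_eq_same, sub_self]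
          · rw [Pi.single_eq_of_ne hs, mul_inv_cancel_left₀ (mt (hz s).1 hs)]
            exact (sub_zero _).symm
        rw [← hy, ← aeval_dualDivRoot hK, LinearMap.mem_ker.1 hl]
        rfl
      right_inv := fun m => by
        refine LinearMap.ext fun x => ?_
        change m ((Pi.single r' x : CyclicSum φ k) r') = m x
        rw [Pi.single_eq_same] }
  have := finite_adjoinRoot (φ := φ) r'
  rw [Nat.card_congr e, natCard_semilinear hK, Module.finrank_pi_fintype, Finset.sum_const,
    Finset.card_univ, Fintype.card_fin, smul_eq_mul,
    (AdjoinRoot.powerBasis (Fact.out : Irreducible (φ r')).ne_zero).finrank,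
    AdjoinRoot.powerBasis_dim]

variable [Fintype ι]

/-- As `T` is invertible, invariance of `β` says that `x ↦ β(x, ·)` intertwines `T` with the adjoint
of `T⁻¹`. Such maps are tuples in the kernels just counted. -/
theorem ncard_invSesq (hK : Module.finrank F K = 2)
    (h0 : ∀ s, (φ s).coeff 0 ≠ 0) (hm : ∀ s, (φ s).Monic) (hφ : Function.Injective φ) (τ : ι → ι)
    (hτ : ∀ r, φ (τ r) = tildeConj F K (φ r)) :
    (invSesq F (mulRoot φ k)).ncard =
      ∏ r, (Nat.card K ^ (k (τ r) * (φ (τ r)).natDegree)) ^ k r := by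
  have e : invSesq F (mulRoot φ k) ≃ {g : CyclicSum φ k →ₗ[K] (CyclicSum φ k →ₛₗ[conj F K] K) //
      g ∘ₗ mulRoot φ k = dualDivRoot F φ k ∘ₗ g} :=
    Equiv.subtypeEquivRight fun β => by
      constructor
      · intro h
        refine LinearMap.ext fun x => LinearMap.ext fun y => ?_
        change β (mulRoot φ k x) y = β x (divRoot φ k y)
        rw [← h x, mulRoot_divRoot h0]
      · intro h x y
        have := LinearMap.congr_fun (LinearMap.congr_fun h x) (mulRoot φ k y)
        refine this.trans ?_
        change β x (divRoot φ k (mulRoot φ k y)) = _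
        rw [divRoot_mulRoot h0]
  rw [← Nat.card_coe_set_eq, Nat.card_congr (e.trans (equivariantEquiv _)), Nat.card_pi]
  refine Finset.prod_congr rfl fun r _ => ?_
  rw [Nat.card_pi, Finset.prod_const, Finset.card_univ, Fintype.card_fin,
    natCard_kerAeval_dualDivRoot hK h0 hm hφ r (τ r) (hτ r)]

theorem ncard_invHerm (hK : Module.finrank F K = 2)
    (h0 : ∀ s, (φ s).coeff 0 ≠ 0) (hm : ∀ s, (φ s).Monic) (hφ : Function.Injective φ) (τ : ι → ι)
    (hτ : ∀ r, φ (τ r) = tildeConj F K (φ r)) :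
    (invHerm F (mulRoot φ k)).ncard =
      ∏ r, Fintype.card F ^ ((φ (τ r)).natDegree * k r * k (τ r)) := by
  refine Nat.pow_left_injective (n := 2) two_ne_zero ?_
  change (invHerm F (mulRoot φ k)).ncard ^ 2 = _ ^ 2
  rw [ncard_invHerm_sq hK, ncard_invSesq hK h0 hm hφ τ hτ, ← Finset.prod_pow]
  refine Finset.prod_congr rfl fun r _ => ?_
  rw [card_eq_sq hK]
  ring

end CyclicForms

/-! ### The conjugation `φ ↦ φ̃` -/

section TildeConj

variable {F K : Type*} [Field F] [Fintype F] [Field K] [Algebra F K]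

theorem coeff_zero_map_conj_ne_zero {f : K[X]} (hf : f.coeff 0 ≠ 0) :
    (f.map (conj F K)).coeff 0 ≠ 0 := by
  rw [coeff_map]
  exact (_root_.map_ne_zero _).2 hf

theorem reverse_reverse_of_coeff_zero_ne_zero {f : K[X]} (hf : f.coeff 0 ≠ 0) :
    f.reverse.reverse = f := by
  have h : f.reverse.natDegree = f.natDegree := by
    rw [reverse_natDegree, natTrailingDegree_eq_zero.2 (Or.inr hf), Nat.sub_zero]
  rw [reverse, h, reverse, reflect_reflect]

theorem natDegree_tildeConj {f : K[X]} (hf : f.coeff 0 ≠ 0) :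
    (tildeConj F K f).natDegree = f.natDegree := by
  rw [tildeConj, natDegree_C_mul (inv_ne_zero ((_root_.map_ne_zero _).2 hf)), reverse_natDegree,
    natTrailingDegree_eq_zero.2 (Or.inr (coeff_zero_map_conj_ne_zero (F := F) hf)),
    natDegree_map, Nat.sub_zero]

theorem monic_tildeConj {f : K[X]} (hf : f.coeff 0 ≠ 0) : (tildeConj F K f).Monic := by
  rw [Monic, tildeConj, leadingCoeff_mul, leadingCoeff_C, reverse_leadingCoeff, trailingCoeff,
    natTrailingDegree_eq_zero.2 (Or.inr (coeff_zero_map_conj_ne_zero (F := F) hf)), coeff_map]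
  exact inv_mul_cancel₀ ((_root_.map_ne_zero _).2 hf)

theorem coeff_zero_tildeConj {f : K[X]} (hf : f.Monic) :
    (tildeConj F K f).coeff 0 = (conj F K (f.coeff 0))⁻¹ := by
  rw [tildeConj, coeff_C_mul, coeff_zero_reverse, (hf.map _).leadingCoeff, mul_one]

theorem coeff_zero_tildeConj_ne_zero {f : K[X]} (hf : f.Monic) (h0 : f.coeff 0 ≠ 0) :
    (tildeConj F K f).coeff 0 ≠ 0 := by
  rw [coeff_zero_tildeConj hf]
  exact inv_ne_zero ((_root_.map_ne_zero _).2 h0)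

theorem tildeConj_mul (f g : K[X]) :
    tildeConj F K (f * g) = tildeConj F K f * tildeConj F K g := by
  rw [tildeConj, tildeConj, tildeConj, mul_coeff_zero, map_mul, mul_inv, Polynomial.map_mul,
    reverse_mul_of_domain, C_mul]
  ring

theorem tildeConj_tildeConj (hK : Module.finrank F K = 2) {f : K[X]} (hf : f.Monic)
    (h0 : f.coeff 0 ≠ 0) : tildeConj F K (tildeConj F K f) = f := by
  have h1 : ((f.map (conj F K)).reverse.map (conj F K)) = f.reverse := by
    rw [reverse, reverse, reflect_map, natDegree_map, Polynomial.map_map]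
    refine (Polynomial.ext fun n => ?_)
    rw [coeff_map]
    exact conj_conj hK _
  rw [tildeConj, coeff_zero_tildeConj hf, map_inv₀ (conj F K), inv_inv, conj_conj hK, tildeConj,
    Polynomial.map_mul, map_C, map_inv₀ (conj F K), conj_conj hK, h1, reverse_mul_of_domain, reverse_C,
    reverse_reverse_of_coeff_zero_ne_zero h0, ← mul_assoc, ← C_mul, mul_inv_cancel₀ h0, C_1,
    one_mul]

theorem irreducible_tildeConj (hK : Module.finrank F K = 2) {f : K[X]} (hf : f.Monic)
    (h0 : f.coeff 0 ≠ 0) (hi : Irreducible f) : Irreducible (tildeConj F K f) := by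
  constructor
  · intro h
    have := natDegree_eq_zero_of_isUnit h
    rw [natDegree_tildeConj h0] at this
    exact hi.natDegree_pos.ne' this
  · intro a b hab
    have h1 := tildeConj_tildeConj hK hf h0
    have h2 := coeff_zero_tildeConj_ne_zero (F := F) hf h0
    rw [hab, mul_coeff_zero] at h2
    rw [hab, tildeConj_mul] at h1
    have key : ∀ c : K[X], c.coeff 0 ≠ 0 → IsUnit (tildeConj F K c) → IsUnit c := by
      intro c hc hu
      have h3 := natDegree_eq_zero_of_isUnit hu
      rw [natDegree_tildeConj hc] at h3
      rw [eq_C_of_natDegree_eq_zero h3, isUnit_C]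
      exact hc.isUnit
    rcases hi.isUnit_or_isUnit h1.symm with h | h
    · exact Or.inl (key a (left_ne_zero_of_mul h2) h)
    · exact Or.inr (key b (right_ne_zero_of_mul h2) h)

/-- A self-conjugate irreducible polynomial has odd degree. -/
theorem odd_natDegree_of_eq_tildeConj (hK : Module.finrank F K = 2) {f : K[X]}
    (h0 : f.coeff 0 ≠ 0) (hi : Irreducible f) (h : f = tildeConj F K f) : Odd f.natDegree := by
  have := finite_of_finrank_eq_two hK
  have := Fintype.ofFinite K
  have : Fact (Irreducible f) := ⟨hi⟩
  have hfin := (AdjoinRoot.powerBasis hi.ne_zero).finite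
  have : Finite (AdjoinRoot f) := Module.finite_of_finite K
  set r := AdjoinRoot.root f with hr
  have h1 : aeval r⁻¹ (f.map (conj F K)) = 0 := by
    rw [aeval_root_tildeConj_eq_zero_iff h0 h0, ← h, AdjoinRoot.aeval_eq, AdjoinRoot.mk_self]
  have h2 : aeval (r⁻¹ ^ Fintype.card F) f = 0 := by
    have h3 := congrArg (conj F (AdjoinRoot f)) h1
    rw [map_zero, aeval_def, eval₂_map, hom_eval₂] at h3
    rw [aeval_def, ← h3]
    congr 1
    ext c
    simp only [RingHom.comp_apply]
    rw [conj_apply, ← map_pow, ← conj_apply F, conj_conj hK]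
  -- Self-conjugacy makes `r ↦ r^(-q)` a `K`-automorphism `τ` whose square is the Frobenius over
  -- `K`. That Frobenius has order `d = deg f` and generates all automorphisms, so `τ^d = 1`; for `d
  -- = 2e` its `e`-th power would be trivial.
  let τ : AdjoinRoot f →ₐ[K] AdjoinRoot f :=
    AdjoinRoot.liftAlgHom f (Algebra.ofId K (AdjoinRoot f)) (r⁻¹ ^ Fintype.card F) h2
  have hτr : τ r = r⁻¹ ^ Fintype.card F := AdjoinRoot.liftAlgHom_root ..
  have hττ : τ * τ = FiniteField.frobeniusAlgHom K (AdjoinRoot f) := by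
    refine AdjoinRoot.algHom_ext ?_
    change τ (τ r) = r ^ Fintype.card K
    rw [hτr, map_pow, map_inv₀, hτr, ← Nat.card_eq_fintype_card (α := K), card_eq_sq hK,
      ← inv_pow, inv_inv, ← pow_mul, pow_two]
  have hord := FiniteField.orderOf_frobeniusAlgHom K (AdjoinRoot f)
  rw [(AdjoinRoot.powerBasis hi.ne_zero).finrank, AdjoinRoot.powerBasis_dim] at hord
  obtain ⟨m, hm⟩ := (FiniteField.bijective_frobeniusAlgHom_pow K (AdjoinRoot f)).2 τ
  have hτd : τ ^ f.natDegree = 1 := by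
    rw [← hm, ← pow_mul, mul_comm, pow_mul, ← hord, pow_orderOf_eq_one, one_pow]
  rw [← Nat.not_even_iff_odd]
  rintro ⟨e, he⟩
  have h5 : FiniteField.frobeniusAlgHom K (AdjoinRoot f) ^ e = 1 := by
    rw [← hττ, ← pow_two, ← pow_mul, two_mul, ← he, hτd]
  have h6 := orderOf_dvd_of_pow_eq_one h5
  rw [hord] at h6
  have := hi.natDegree_pos
  have := Nat.le_of_dvd (by omega) h6
  omega

end TildeConj

/-! ### Irreducible factors of the characteristic polynomial -/

section CharPoly

variable {K : Type*} [Field K]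

theorem aeval_mulVecLin {n : ℕ} (A : Matrix (Fin n) (Fin n) K) (f : K[X]) :
    aeval (A.mulVecLin : Module.End K (Fin n → K)) f = (aeval A f).mulVecLin := by
  have := aeval_algHom_apply (Matrix.toLinAlgEquiv' (R := K) (n := Fin n)) A f
  exact this

/-- An irreducible polynomial divides the characteristic polynomial of `A` iff `f(A)` has a
nontrivial kernel. -/
theorem dvd_charpoly_iff {n : ℕ} (A : Matrix (Fin n) (Fin n) K) {f : K[X]} (hf : Irreducible f) :
    f ∣ A.charpoly ↔ kerAeval A.mulVecLin f ≠ ⊥ := by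
  rw [Ne, Submodule.eq_bot_iff]
  constructor
  · intro h hbot
    have : Fact (Irreducible f) := ⟨hf⟩
    -- Over `K[X]/(f)` the root of `f` is an eigenvalue of `A`, so `0` is an eigenvalue of `f(A)`;
    -- its determinant vanishes there and hence over `K`.
    have hroot : IsRoot (A.map (algebraMap K (AdjoinRoot f))).charpoly (AdjoinRoot.root f) := by
      rw [Matrix.charpoly_map, IsRoot.def, eval_map_algebraMap, AdjoinRoot.aeval_eq]
      exact AdjoinRoot.mk_eq_zero.2 h
    have h1 := spectrum.subset_polynomial_aeval _ (f.map (algebraMap K (AdjoinRoot f)))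
      ⟨_, Matrix.mem_spectrum_of_isRoot_charpoly hroot, rfl⟩
    have h2 : eval (AdjoinRoot.root f) (f.map (algebraMap K (AdjoinRoot f))) = 0 := by
      rw [eval_map_algebraMap, AdjoinRoot.aeval_eq, AdjoinRoot.mk_self]
    have h3 : aeval (A.map (algebraMap K (AdjoinRoot f))) (f.map (algebraMap K (AdjoinRoot f))) =
        (aeval A f).map (algebraMap K (AdjoinRoot f)) := by
      rw [aeval_map_algebraMap]
      exact aeval_algHom_apply (Algebra.ofId K (AdjoinRoot f)).mapMatrix A f
    beta_reduce at h1
    rw [h2, h3, spectrum.zero_mem_iff, Matrix.isUnit_iff_isUnit_det] at h1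
    have h4 : (aeval A f).det = 0 := by
      by_contra hne
      refine h1 ?_
      have h5 := RingHom.map_det (algebraMap K (AdjoinRoot f)) (aeval A f)
      rw [RingHom.mapMatrix_apply] at h5
      rw [← h5]
      exact ((_root_.map_ne_zero _).2 hne).isUnit
    obtain ⟨v, hv, hv0⟩ := Matrix.exists_mulVec_eq_zero_iff.2 h4
    refine hv (hbot v ?_)
    rw [LinearMap.mem_ker, aeval_mulVecLin]
    exact hv0
  · intro h
    by_contra hdvd
    refine h fun v hv => ?_
    have hd := Polynomial.disjoint_ker_aeval_of_isCoprime (A.mulVecLin : Module.End K (Fin n → K))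
      ((hf.coprime_iff_not_dvd).2 hdvd)
    refine Submodule.disjoint_def.1 hd v hv ?_
    rw [LinearMap.mem_ker, aeval_mulVecLin, Matrix.aeval_self_charpoly, Matrix.mulVecLin_zero,
      LinearMap.zero_apply]

end CharPoly

/-! ### The finite set of irreducible polynomials of small degree -/

section SmallPolynomials

variable (F K : Type*) [Field F] [Fintype F] [Field K] [Algebra F K]

/-- The monic irreducible polynomials of degree at most `t` with nonzero constant term. -/
def SmallPoly (K : Type*) [Field K] (t : ℕ) : Type _ :=
  {f : K[X] // f.Monic ∧ Irreducible f ∧ f.natDegree ≤ t ∧ f.coeff 0 ≠ 0}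

variable {F K} {t : ℕ}

instance (s : SmallPoly K t) : Fact (Irreducible s.1) := ⟨s.2.2.1⟩

theorem finite_smallPoly [Finite K] (t : ℕ) : Finite (SmallPoly K t) := by
  refine Finite.of_injective (fun s : SmallPoly K t => fun i : Fin (t + 1) => s.1.coeff i) ?_
  intro s s' h
  refine Subtype.ext (Polynomial.ext fun i => ?_)
  by_cases hi : i < t + 1
  · exact congrFun h ⟨i, hi⟩
  · rw [coeff_eq_zero_of_natDegree_lt, coeff_eq_zero_of_natDegree_lt]
    · have := s'.2.2.2.1; omega
    · have := s.2.2.2.1; omega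

/-- Conjugation of small polynomials. -/
def SmallPoly.tilde (hK : Module.finrank F K = 2) (s : SmallPoly K t) : SmallPoly K t :=
  ⟨tildeConj F K s.1, monic_tildeConj s.2.2.2.2,
    irreducible_tildeConj hK s.2.1 s.2.2.2.2 s.2.2.1,
    (natDegree_tildeConj s.2.2.2.2).trans_le s.2.2.2.1,
    coeff_zero_tildeConj_ne_zero s.2.1 s.2.2.2.2⟩

theorem SmallPoly.tilde_tilde (hK : Module.finrank F K = 2) (s : SmallPoly K t) :
    (s.tilde hK).tilde hK = s := Subtype.ext (tildeConj_tildeConj hK s.2.1 s.2.2.2.2)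

theorem SmallPoly.natDegree_tilde (hK : Module.finrank F K = 2) (s : SmallPoly K t) :
    (s.tilde hK).1.natDegree = s.1.natDegree := natDegree_tildeConj s.2.2.2.2

theorem SmallPoly.pairwise_isCoprime :
    Pairwise fun s s' : SmallPoly K t => IsCoprime s.1 s'.1 := by
  intro s s' h
  rw [s.2.2.1.coprime_iff_not_dvd]
  intro hd
  exact h (Subtype.ext (eq_of_monic_of_associated s.2.1 s'.2.1
    (s.2.2.1.associated_of_dvd s'.2.2.1 hd)))

/-- Factors may be normalised to be monic, and `X` is never a factor because `A` is invertible. -/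
theorem noSmallFactor_iff {n : ℕ} (A : GU F K n) :
    NoSmallFactor t ((A : Matrix.GeneralLinearGroup (Fin n) K) : Matrix (Fin n) (Fin n) K) ↔
      ∀ s : SmallPoly K t,
        Module.finrank (AdjoinRoot s.1) (kerAeval (act A) s.1) = 0 := by
  classical
  have hfin : ∀ s : SmallPoly K t,
      Module.finrank (AdjoinRoot s.1) (kerAeval (act A) s.1) = 0 ↔ kerAeval (act A) s.1 = ⊥ := by
    intro s
    have : Module.Finite (AdjoinRoot s.1) (kerAeval (act A) s.1) :=
      Module.Finite.of_restrictScalars_finite K _ _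
    rw [Module.finrank_eq_zero_iff_of_free, Submodule.subsingleton_iff_eq_bot]
  simp only [hfin]
  constructor
  · intro h s
    by_contra hne
    have := h s.1 s.2.2.1 ((dvd_charpoly_iff _ s.2.2.1).2 hne)
    have := s.2.2.2.1
    omega
  · intro h f hf hd
    by_contra hlt
    have hf0 := hf.ne_zero
    have hassoc := associated_normalize f
    have hdeg : (normalize f).natDegree = f.natDegree :=
      natDegree_eq_of_degree_eq (degree_eq_degree_of_associated hassoc.symm)
    have hi := hassoc.irreducible hf
    have hd' : normalize f ∣ _ := hassoc.symm.dvd.trans hd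
    refine (dvd_charpoly_iff _ hi).1 hd' (h ⟨normalize f, monic_normalize hf0, hi, by omega, ?_⟩)
    intro hc
    have hX := (X_dvd_iff.2 hc).trans hd'
    rw [X_dvd_iff] at hX
    have hdet := Matrix.det_eq_sign_charpoly_coeff
      ((A : Matrix.GeneralLinearGroup (Fin n) K) : Matrix (Fin n) (Fin n) K)
    rw [hX, mul_zero] at hdet
    exact (Matrix.isUnit_iff_isUnit_det _).1 (Units.isUnit A.1) |>.ne_zero hdet

end SmallPolynomials

/-! ### q-series: inversion and Euler-type products -/

section QSeries

/-- The coefficients of the inversion formula for numbers of embeddings. -/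
def coef (X : ℝ) (k : ℕ) : ℝ := (-1) ^ k / ∏ i ∈ Finset.range k, (X ^ (i + 1) - 1)

theorem coef_zero (X : ℝ) : coef X 0 = 1 := by simp [coef]

theorem coef_succ (X : ℝ) (k : ℕ) : coef X (k + 1) = -coef X k / (X ^ (k + 1) - 1) := by
  rw [coef, coef, Finset.prod_range_succ, pow_succ, ← div_div]
  ring

theorem pow_succ_sub_one_ne_zero {X : ℝ} (hX : 1 < X) (i : ℕ) : X ^ (i + 1) - 1 ≠ 0 :=
  (sub_pos.2 (one_lt_pow₀ hX i.succ_ne_zero)).ne'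

theorem coef_ne_zero {X : ℝ} (hX : 1 < X) (k : ℕ) : coef X k ≠ 0 :=
  div_ne_zero (pow_ne_zero _ (by norm_num))
    (Finset.prod_ne_zero_iff.2 fun i _ => pow_succ_sub_one_ne_zero hX i)

/-- The coefficients are chosen so that every partial sum factors completely. At `Y = X^w` with `N =
w > 0` the factor `i = w - 1` vanishes: the sum detects `w = 0`. -/
theorem sum_coef_mul_prod {X : ℝ} (hX : 1 < X) (Y : ℝ) (N : ℕ) :
    ∑ k ∈ Finset.range (N + 1), coef X k * ∏ i ∈ Finset.range k, (Y - X ^ i) =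
      coef X N * ∏ i ∈ Finset.range N, (Y - X ^ (i + 1)) := by
  induction N with
  | zero => simp
  | succ N ih =>
    rw [Finset.sum_range_succ, ih, coef_succ, Finset.prod_range_succ' (fun i => Y - X ^ i),
      Finset.prod_range_succ (fun i => Y - X ^ (i + 1)) N]
    have := pow_succ_sub_one_ne_zero hX N
    field_simp
    ring

/-- The inversion formula, detecting dimension zero. -/
theorem hasSum_coef_mul_prod {X : ℝ} (hX : 1 < X) (w : ℕ) :
    HasSum (fun k => coef X k * ∏ i ∈ Finset.range k, (X ^ w - X ^ i)) (if w = 0 then 1 else 0) := by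
  have h : ∑ k ∈ Finset.range (w + 1), coef X k * ∏ i ∈ Finset.range k, (X ^ w - X ^ i) =
      if w = 0 then 1 else 0 := by
    rw [sum_coef_mul_prod hX]
    split_ifs with hw
    · subst hw; simp [coef]
    · rw [Finset.prod_eq_zero (i := w - 1) (Finset.mem_range.2 (by omega)), mul_zero]
      rw [Nat.sub_add_cancel (by omega), sub_self]
  rw [← h]
  refine hasSum_sum_of_ne_finset_zero fun k hk => ?_
  rw [Finset.prod_eq_zero (i := w) (Finset.mem_range.2 (by simpa using hk)) (sub_self _), mul_zero]

theorem summable_coef_mul_pow {X : ℝ} (hX : 1 < X) (z : ℝ) :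
    Summable fun k => coef X k * z ^ k := by
  by_cases hz : z = 0
  · subst hz
    refine summable_of_ne_finset_zero (s := {0}) fun k hk => ?_
    rw [zero_pow (by simpa using hk), mul_zero]
  refine summable_of_ratio_test_tendsto_lt_one (l := 0) one_pos
    (Eventually.of_forall fun k => mul_ne_zero (coef_ne_zero hX k) (pow_ne_zero k hz)) ?_
  have h1 : Tendsto (fun k : ℕ => ‖z‖ * (X ^ (k + 1) - 1)⁻¹) atTop (𝓝 (‖z‖ * 0)) :=
    ((tendsto_inv_atTop_zero.comp (tendsto_atTop_add_const_right _ (-1)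
      ((tendsto_pow_atTop_atTop_of_one_lt hX).comp (tendsto_add_atTop_nat 1))))).const_mul _
  rw [mul_zero] at h1
  refine h1.congr fun k => ?_
  have h2 := coef_ne_zero hX k
  have h3 : 0 < X ^ (k + 1) - 1 := sub_pos.2 (one_lt_pow₀ hX k.succ_ne_zero)
  rw [coef_succ, pow_succ z, norm_mul, norm_mul, norm_mul, norm_div, norm_neg,
    Real.norm_of_nonneg h3.le]
  field_simp

/-- The generating function of `coef`. -/
def coefSum (X z : ℝ) : ℝ := ∑' k, coef X k * z ^ k

/-- The recursion `coef (k+1) * (X^(k+1) - 1) = -coef k`, summed against powers of `z`. -/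
theorem coefSum_mul {X : ℝ} (hX : 1 < X) (z : ℝ) :
    coefSum X (X * z) = (1 - z) * coefSum X z := by
  have h1 := summable_coef_mul_pow hX (X * z)
  have h2 := summable_coef_mul_pow hX z
  have h3 : coefSum X (X * z) - coefSum X z = -z * coefSum X z := by
    rw [coefSum, coefSum, ← h1.tsum_sub h2, ← tsum_mul_left, (h1.sub h2).tsum_eq_zero_add]
    simp only [pow_zero, sub_self, zero_add]
    refine tsum_congr fun k => ?_
    rw [coef_succ]
    have := pow_succ_sub_one_ne_zero hX k
    field_simp
    ring
  linear_combination h3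

theorem coefSum_pow_succ {X : ℝ} (hX : 1 < X) (k : ℕ) : coefSum X (X ^ (k + 1)) = 0 := by
  induction k with
  | zero => simpa using coefSum_mul hX 1
  | succ k ih => rw [pow_succ', coefSum_mul hX, ih, mul_zero]

/-- A power series that converges at `1` is right-continuous at `0` along geometric sequences. -/
theorem tendsto_tsum_mul_pow {a : ℕ → ℝ} (ha : Summable fun k => ‖a k‖) {r : ℝ} (hr0 : 0 ≤ r)
    (hr1 : r < 1) : Tendsto (fun N : ℕ => ∑' k, a k * (r ^ N) ^ k) atTop (𝓝 (a 0)) := by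
  have h := tendsto_tsum_of_dominated_convergence (𝓕 := atTop)
    (f := fun (N : ℕ) k => a k * (r ^ N) ^ k) (g := fun k => if k = 0 then a 0 else 0)
    ha (fun k => ?_) (Eventually.of_forall fun N k => ?_)
  · rwa [tsum_ite_eq] at h
  · rcases k with _ | k
    · simp
    · have h1 := (tendsto_pow_atTop_nhds_zero_of_lt_one (pow_nonneg hr0 (k + 1))
        (pow_lt_one₀ hr0 hr1 k.succ_ne_zero)).const_mul (a (k + 1))
      rw [mul_zero] at h1
      simpa [← pow_mul, mul_comm] using h1
  · rw [norm_mul, norm_pow, norm_pow, Real.norm_of_nonneg hr0, ← pow_mul]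
    exact mul_le_of_le_one_right (norm_nonneg _) (pow_le_one₀ hr0 hr1.le)

theorem multipliable_one_add_mul_pow {r : ℝ} (hr : |r| < 1) (c : ℝ) :
    Multipliable fun i : ℕ => 1 + c * r ^ (i + 1) := by
  refine Real.multipliable_one_add_of_summable ?_
  exact ((summable_nat_add_iff 1).2 (summable_geometric_of_abs_lt_one hr)).mul_left c

/-- The functional equation is iterated along `1, X⁻¹, X⁻², …` towards `0`, where the series takes
the value `1`. -/
theorem coefSum_one {X : ℝ} (hX : 1 < X) : coefSum X 1 = ∏' i : ℕ, (1 - X⁻¹ ^ (i + 1)) := by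
  have hX0 : X ≠ 0 := by positivity
  have hr0 : 0 ≤ X⁻¹ := by positivity
  have hr1 : X⁻¹ < 1 := inv_lt_one_of_one_lt₀ hX
  have h1 : ∀ N : ℕ, coefSum X 1 =
      (∏ i ∈ Finset.range N, (1 - X⁻¹ ^ (i + 1))) * coefSum X (X⁻¹ ^ N) := by
    intro N
    induction N with
    | zero => simp
    | succ N ih =>
      rw [ih, Finset.prod_range_succ, mul_assoc, ← coefSum_mul hX, pow_succ',
        mul_inv_cancel_left₀ hX0]
  have h2 : Multipliable fun i : ℕ => 1 - X⁻¹ ^ (i + 1) := by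
    simpa [sub_eq_add_neg] using multipliable_one_add_mul_pow (r := X⁻¹)
      (by rwa [abs_of_nonneg hr0]) (-1)
  have h3 : Tendsto (fun N : ℕ => coefSum X (X⁻¹ ^ N)) atTop (𝓝 1) := by
    have := tendsto_tsum_mul_pow (a := coef X)
      (by simpa using (summable_coef_mul_pow hX 1).norm) hr0 hr1
    rwa [coef_zero] at this
  have h4 := (h2.hasProd.tendsto_prod_nat).mul h3
  rw [mul_one] at h4
  exact tendsto_nhds_unique (tendsto_const_nhds.congr h1) h4

/-- The series attached to a self-conjugate polynomial, as a power series. -/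
def selfCoef (b : ℝ) (k : ℕ) : ℝ := coef (b ^ 2) k * b ^ (k ^ 2)

theorem selfCoef_zero (b : ℝ) : selfCoef b 0 = 1 := by simp [selfCoef, coef_zero]

theorem selfCoef_succ {b : ℝ} (hb : 1 < b) (k : ℕ) :
    selfCoef b (k + 1) * (1 - b⁻¹ ^ (2 * (k + 1))) = -b⁻¹ * selfCoef b k := by
  have h0 : b ≠ 0 := by positivity
  have h1 := pow_succ_sub_one_ne_zero (one_lt_pow₀ hb two_ne_zero) k
  rw [selfCoef, selfCoef, coef_succ, inv_pow, pow_mul b 2 (k + 1)]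
  have h2 : (b ^ 2) ^ (k + 1) ≠ 0 := by positivity
  have h3 : b ^ ((k + 1) ^ 2) * b = b ^ (k ^ 2) * (b ^ 2) ^ (k + 1) := by
    rw [← pow_mul, ← pow_succ, ← pow_add]
    congr 1
    ring
  field_simp
  linear_combination (-(coef (b ^ 2) k)) * h3

theorem summable_selfCoef {b : ℝ} (hb : 1 < b) : Summable fun k => ‖selfCoef b k‖ := by
  have h0 : 0 < b := by positivity
  have hb1 : b⁻¹ < 1 := inv_lt_one_of_one_lt₀ hb
  have hne : ∀ k, selfCoef b k ≠ 0 := fun k =>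
    mul_ne_zero (coef_ne_zero (one_lt_pow₀ hb two_ne_zero) k) (pow_ne_zero _ h0.ne')
  have hpos : ∀ k : ℕ, 0 < 1 - b⁻¹ ^ (2 * (k + 1)) := fun k =>
    sub_pos.2 (pow_lt_one₀ (by positivity) hb1 (by omega))
  refine summable_of_ratio_test_tendsto_lt_one hb1
    (Eventually.of_forall fun k => norm_ne_zero_iff.2 (hne k)) ?_
  have h1 : Tendsto (fun k : ℕ => b⁻¹ * (1 - b⁻¹ ^ (2 * (k + 1)))⁻¹) atTop
      (𝓝 (b⁻¹ * (1 - 0)⁻¹)) := by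
    refine Tendsto.const_mul _ (Tendsto.inv₀ (Tendsto.const_sub _ ?_) (by norm_num))
    exact (tendsto_pow_atTop_nhds_zero_of_lt_one (by positivity) hb1).comp
      (tendsto_atTop_mono (fun k => by omega : ∀ k, k ≤ 2 * (k + 1)) tendsto_id)
  rw [sub_zero, inv_one, mul_one] at h1
  refine h1.congr fun k => ?_
  have h2 := congrArg norm (selfCoef_succ hb k)
  rw [norm_mul, norm_mul, norm_neg, Real.norm_of_nonneg (hpos k).le,
    Real.norm_of_nonneg (inv_pos.2 h0).le] at h2
  rw [norm_norm, norm_norm, eq_div_iff (norm_ne_zero_iff.2 (hne k)), mul_right_comm, ← h2,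
    mul_inv_cancel_right₀ (hpos k).ne']

/-- For `S(z) = ∑ selfCoef b k * z^k`, `selfCoef_succ` gives `S(z/b²) = (1 + z/b) S(z)`. Iterating
from `z = 1`, the expression is `S(b^(-2N))`, which tends to `S(0) = 1`. -/
theorem tendsto_prod_mul_tsum_selfCoef {b : ℝ} (hb : 1 < b) :
    Tendsto (fun N : ℕ => (∏ i ∈ Finset.range N, (1 + b⁻¹ ^ (2 * i + 1))) * ∑' k, selfCoef b k)
      atTop (𝓝 1) := by
  have h0 : 0 < b := by positivity
  have hb1 : b⁻¹ < 1 := inv_lt_one_of_one_lt₀ hb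
  have hr0 : 0 ≤ b⁻¹ ^ 2 := by positivity
  have hr1 : b⁻¹ ^ 2 < 1 := pow_lt_one₀ (by positivity) hb1 two_ne_zero
  have hs : ∀ N : ℕ, Summable fun k => selfCoef b k * ((b⁻¹ ^ 2) ^ N) ^ k := fun N =>
    Summable.of_norm_bounded (summable_selfCoef hb) fun k => by
      rw [norm_mul, Real.norm_of_nonneg (pow_nonneg (pow_nonneg hr0 N) k)]
      exact mul_le_of_le_one_right (norm_nonneg _)
        (pow_le_one₀ (pow_nonneg hr0 N) (pow_le_one₀ hr0 hr1.le))
  have key : ∀ N : ℕ, ∑' k, selfCoef b k * ((b⁻¹ ^ 2) ^ (N + 1)) ^ k =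
      (1 + b⁻¹ ^ (2 * N + 1)) * ∑' k, selfCoef b k * ((b⁻¹ ^ 2) ^ N) ^ k := by
    intro N
    have h : ∑' k, selfCoef b k * ((b⁻¹ ^ 2) ^ N) ^ k -
        ∑' k, selfCoef b k * ((b⁻¹ ^ 2) ^ (N + 1)) ^ k =
        -b⁻¹ ^ (2 * N + 1) * ∑' k, selfCoef b k * ((b⁻¹ ^ 2) ^ N) ^ k := by
      rw [← (hs N).tsum_sub (hs (N + 1)), ((hs N).sub (hs (N + 1))).tsum_eq_zero_add,
        ← tsum_mul_left]
      simp only [pow_zero, sub_self, zero_add]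
      refine tsum_congr fun k => ?_
      have h2 := selfCoef_succ hb k
      have h3 : ((b⁻¹ ^ 2) ^ (N + 1)) ^ (k + 1) =
          b⁻¹ ^ (2 * (k + 1)) * ((b⁻¹ ^ 2) ^ N) ^ (k + 1) := by
        simp only [← pow_mul, ← pow_add]
        congr 1
        ring
      have h4 : ((b⁻¹ ^ 2) ^ N) ^ (k + 1) * b⁻¹ = b⁻¹ ^ (2 * N + 1) * ((b⁻¹ ^ 2) ^ N) ^ k := by
        simp only [← pow_mul, ← pow_add, ← pow_succ]
        congr 1
        ring
      rw [h3]
      linear_combination ((b⁻¹ ^ 2) ^ N) ^ (k + 1) * h2 - selfCoef b k * h4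
    linear_combination -h
  have h1 : ∀ N : ℕ, ∑' k, selfCoef b k * ((b⁻¹ ^ 2) ^ N) ^ k =
      (∏ i ∈ Finset.range N, (1 + b⁻¹ ^ (2 * i + 1))) * ∑' k, selfCoef b k := by
    intro N
    induction N with
    | zero => simp
    | succ N ih => rw [key, ih, Finset.prod_range_succ]; ring
  have := tendsto_tsum_mul_pow (summable_selfCoef hb) hr0 hr1
  rw [selfCoef_zero] at this
  exact this.congr h1

/-- The sum is the inverse of the product of `1 + b^(-i)` over odd `i`, and Euler's
odd-versus-distinct argument turns that inverse into the product of `1 + (-b)^(-i)` over all `i`.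
Its finite form `hid` has a left side tending to `1`, being a ratio of partial products with the
same nonzero limit. -/
theorem tsum_selfCoef {b : ℝ} (hb : 1 < b) :
    ∑' k, selfCoef b k = ∏' i : ℕ, (1 + (-b⁻¹) ^ (i + 1)) := by
  have h0 : 0 < b := by positivity
  have hb0 : 0 < b⁻¹ := by positivity
  have hb1 : b⁻¹ < 1 := inv_lt_one_of_one_lt₀ hb
  have hx1 : b⁻¹ ^ 2 < 1 := pow_lt_one₀ (by positivity) hb1 two_ne_zero
  have hm : Multipliable fun i : ℕ => 1 + (-b⁻¹) ^ (i + 1) := by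
    have h := multipliable_one_add_mul_pow (r := -b⁻¹) (by rwa [abs_neg, abs_of_pos hb0]) 1
    simpa only [one_mul] using h
  have hp : Multipliable fun i : ℕ => 1 - (b⁻¹ ^ 2) ^ (i + 1) := by
    have h := multipliable_one_add_mul_pow (r := b⁻¹ ^ 2)
      (by rwa [abs_of_nonneg (sq_nonneg _)]) (-1)
    simpa only [neg_one_mul, ← sub_eq_add_neg] using h
  have hpos : ∀ i : ℕ, 0 < 1 - (b⁻¹ ^ 2) ^ (i + 1) := fun i =>
    sub_pos.2 (pow_lt_one₀ (by positivity) hx1 i.succ_ne_zero)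
  have hp0 : ∏' i : ℕ, (1 - (b⁻¹ ^ 2) ^ (i + 1)) ≠ 0 := by
    have hsum : Summable fun i : ℕ => ‖-(b⁻¹ ^ 2) ^ (i + 1)‖ := by
      simp only [norm_neg]
      exact ((summable_nat_add_iff 1).2 (summable_geometric_of_lt_one (sq_nonneg _) hx1)).norm
    simp only [sub_eq_add_neg]
    refine tprod_one_add_ne_zero_of_summable (fun i => ?_) hsum
    rw [← sub_eq_add_neg]
    exact (hpos i).ne'
  have ht := hp.hasProd.tendsto_prod_nat
  have h2 : Tendsto (fun N : ℕ => 2 * N) atTop atTop :=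
    tendsto_atTop_mono (fun N => by omega : ∀ N, N ≤ 2 * N) tendsto_id
  have hD := (ht.comp h2).div ht hp0
  rw [div_self hp0] at hD
  have hid : ∀ N : ℕ, (∏ i ∈ Finset.range (2 * N), (1 - (b⁻¹ ^ 2) ^ (i + 1))) /
      ∏ i ∈ Finset.range N, (1 - (b⁻¹ ^ 2) ^ (i + 1)) =
      (∏ i ∈ Finset.range N, (1 + b⁻¹ ^ (2 * i + 1))) *
        ∏ i ∈ Finset.range (2 * N), (1 + (-b⁻¹) ^ (i + 1)) := by
    intro N
    rw [div_eq_iff (Finset.prod_ne_zero_iff.2 fun i _ => (hpos i).ne')]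
    induction N with
    | zero => simp
    | succ N ih =>
      rw [show 2 * (N + 1) = 2 * N + 1 + 1 by ring]
      simp only [Finset.prod_range_succ]
      rw [ih]
      have e1 : (-b⁻¹) ^ (2 * N + 1) = -b⁻¹ ^ (2 * N + 1) := Odd.neg_pow ⟨N, rfl⟩ _
      have e2 : (-b⁻¹) ^ (2 * N + 1 + 1) = b⁻¹ ^ (2 * N + 1 + 1) :=
        Even.neg_pow ⟨N + 1, by ring⟩ _
      rw [e1, e2]
      ring
  have hA := tendsto_prod_mul_tsum_selfCoef hb
  have hB := hm.hasProd.tendsto_prod_nat.comp h2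
  have h5 := (hD.congr hid).mul_const (∑' k, selfCoef b k)
  have h6 := hA.mul hB
  rw [one_mul] at h5 h6
  refine tendsto_nhds_unique h5 (h6.congr fun N => ?_)
  simp only [Function.comp_apply]
  ring

end QSeries

/-! ### Series over tuples of multiplicities -/

section PiSums

theorem summable_and_tsum_prod_fin {β : Type*} (n : ℕ) (f : Fin n → β → ℝ)
    (hf : ∀ s, Summable fun x => ‖f s x‖) :
    (Summable fun k : Fin n → β => ‖∏ s, f s (k s)‖) ∧
      ∑' k : Fin n → β, ∏ s, f s (k s) = ∏ s, ∑' x, f s x := by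
  induction n with
  | zero =>
    constructor
    · exact Summable.of_finite
    · simp [tsum_fintype]
  | succ n ih =>
    obtain ⟨h1, h2⟩ := ih (fun s => f s.succ) fun s => hf s.succ
    let e : β × (Fin n → β) ≃ (Fin (n + 1) → β) := Fin.consEquiv fun _ => β
    have he : ∀ p : β × (Fin n → β), ∏ s, f s (e p s) = f 0 p.1 * ∏ s : Fin n, f s.succ (p.2 s) := by
      intro p
      rw [Fin.prod_univ_succ]
      rfl
    constructor
    · rw [← e.summable_iff]
      refine (Summable.mul_norm (hf 0) h1).congr fun p => ?_
      rw [Function.comp_apply, he]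
    · rw [← e.tsum_eq, Fin.prod_univ_succ, ← h2, tsum_mul_tsum_of_summable_norm (hf 0) h1]
      exact tsum_congr he

variable {ι β : Type*} [Fintype ι]

/-- Summation over functions from a finite type of a product of one-variable terms. -/
theorem summable_and_tsum_prod (f : ι → β → ℝ) (hf : ∀ s, Summable fun x => ‖f s x‖) :
    (Summable fun k : ι → β => ‖∏ s, f s (k s)‖) ∧
      ∑' k : ι → β, ∏ s, f s (k s) = ∏ s, ∑' x, f s x := by
  let e := Fintype.equivFin ι
  obtain ⟨h1, h2⟩ := summable_and_tsum_prod_fin (Fintype.card ι) (fun i => f (e.symm i))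
    fun i => hf _
  have he : ∀ k : ι → β, ∏ i, f (e.symm i) (Equiv.arrowCongr e (Equiv.refl β) k i) =
      ∏ s, f s (k s) := fun k => Fintype.prod_equiv e.symm _ _ fun i => rfl
  constructor
  · rw [← (Equiv.arrowCongr e (Equiv.refl β)).summable_iff] at h1
    refine h1.congr fun k => ?_
    rw [Function.comp_apply, he]
  · rw [← (Equiv.arrowCongr e (Equiv.refl β)).tsum_eq, tsum_congr he] at h2
    rw [h2]
    exact Fintype.prod_equiv e.symm _ _ fun i => rfl

/-- Factorisation over the orbits of an involution. -/
theorem tsum_prod_involution [LinearOrder ι] (τ : ι → ι) (hτ : ∀ s, τ (τ s) = s)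
    (W : ι → ℕ → ℕ → ℝ) (h1 : ∀ s, τ s = s → Summable fun n => ‖W s n n‖)
    (h2 : ∀ s, s < τ s → Summable fun p : ℕ × ℕ => ‖W s p.1 p.2 * W (τ s) p.2 p.1‖) :
    ∑' k : ι → ℕ, ∏ s, W s (k s) (k (τ s)) =
      (∏ s : {s // τ s = s}, ∑' n, W s.1 n n) *
        ∏ s : {s // s < τ s}, ∑' p : ℕ × ℕ, W s.1 p.1 p.2 * W (τ s.1) p.2 p.1 := by
  -- The index set splits into fixed points, the smaller members of the two-element orbits, and
  -- their partners; the order serves only to choose representatives.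
  let E : {s // τ s = s} ⊕ ({s // s < τ s} ⊕ {s // s < τ s}) → ι :=
    Sum.elim Subtype.val (Sum.elim Subtype.val fun s => τ s.1)
  have hE : Function.Bijective E := by
    constructor
    · rintro (a | a | a) (b | b | b) h <;> simp only [E, Sum.elim_inl, Sum.elim_inr] at h
      · rw [Subtype.ext h]
      · exact absurd b.2 (by rw [← h, a.2]; exact lt_irrefl _)
      · exact absurd b.2 (by
          have := a.2
          rw [h, hτ] at this
          rw [← this]; exact lt_irrefl _)
      · exact absurd a.2 (by rw [h, b.2]; exact lt_irrefl _)
      · rw [Subtype.ext h]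
      · have ha := a.2
        rw [h, hτ] at ha
        exact absurd ha b.2.not_gt
      · exact absurd a.2 (by
          have := b.2
          rw [← h, hτ] at this
          rw [← this]; exact lt_irrefl _)
      · have hb := b.2
        rw [← h, hτ] at hb
        exact absurd hb a.2.not_gt
      · have := congrArg τ h
        rw [hτ, hτ] at this
        rw [Subtype.ext this]
    · intro s
      rcases lt_trichotomy (τ s) s with h | h | h
      · exact ⟨Sum.inr (Sum.inr ⟨τ s, by rwa [hτ]⟩), hτ s⟩
      · exact ⟨Sum.inl ⟨s, h⟩, rfl⟩
      · exact ⟨Sum.inr (Sum.inl ⟨s, h⟩), rfl⟩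
  let E' := Equiv.ofBijective E hE
  let e : (ι → ℕ) ≃ ({s // τ s = s} → ℕ) × ({s // s < τ s} → ℕ × ℕ) :=
    ((Equiv.arrowCongr E' (Equiv.refl ℕ)).symm.trans (Equiv.sumArrowEquivProdArrow _ _ _)).trans
      (Equiv.prodCongr (Equiv.refl _) ((Equiv.sumArrowEquivProdArrow _ _ _).trans
        (Equiv.arrowProdEquivProdArrow _ _ _).symm))
  have he : ∀ k : ι → ℕ, ∏ s, W s (k s) (k (τ s)) =
      (∏ s, W s.1 ((e k).1 s) ((e k).1 s)) *
        ∏ s, W s.1 ((e k).2 s).1 ((e k).2 s).2 * W (τ s.1) ((e k).2 s).2 ((e k).2 s).1 := by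
    intro k
    rw [← E'.prod_comp, Fintype.prod_sum_type, Fintype.prod_sum_type, ← Finset.prod_mul_distrib]
    congr 1
    · refine Finset.prod_congr rfl fun s _ => ?_
      change W s.1 (k s.1) (k (τ s.1)) = W s.1 (k s.1) (k s.1)
      rw [s.2]
    · refine Finset.prod_congr rfl fun s _ => ?_
      change W s.1 (k s.1) (k (τ s.1)) * W (τ s.1) (k (τ s.1)) (k (τ (τ s.1))) =
        W s.1 (k s.1) (k (τ s.1)) * W (τ s.1) (k (τ s.1)) (k s.1)
      rw [hτ]
  obtain ⟨a1, a2⟩ := summable_and_tsum_prod (fun (s : {s // τ s = s}) n => W s.1 n n)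
    fun s => h1 s.1 s.2
  obtain ⟨b1, b2⟩ := summable_and_tsum_prod
    (fun (s : {s // s < τ s}) (p : ℕ × ℕ) => W s.1 p.1 p.2 * W (τ s.1) p.2 p.1)
    fun s => h2 s.1 s.2
  rw [← a2, ← b2, tsum_mul_tsum_of_summable_norm a1 b1, ← e.tsum_eq]
  exact tsum_congr he

end PiSums

/-! ### The limiting proportion as a series -/

section Limit

variable {F K : Type*} [Field F] [Fintype F] [Field K] [Algebra F K] {t : ℕ}

/-- The underlying polynomial. -/
def SmallPoly.poly (s : SmallPoly K t) : K[X] := s.1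

instance (s : SmallPoly K t) : Fact (Irreducible s.poly) := ⟨s.2.2.1⟩

theorem SmallPoly.natDegree_pos (s : SmallPoly K t) : 0 < s.poly.natDegree :=
  s.2.2.1.natDegree_pos

instance (k : SmallPoly K t → ℕ) [Finite (SmallPoly K t)] :
    Module.Finite K (CyclicSum SmallPoly.poly k) := by
  have := fun s : SmallPoly K t => finite_adjoinRoot (φ := SmallPoly.poly) s
  infer_instance

variable (F) in
/-- The cardinality of `F`, to the degree of the polynomial. -/
def SmallPoly.base (s : SmallPoly K t) : ℝ := (Fintype.card F : ℝ) ^ s.poly.natDegree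

omit [Algebra F K] in
theorem SmallPoly.one_lt_base (s : SmallPoly K t) : 1 < s.base F :=
  one_lt_pow₀ (by exact_mod_cast Fintype.one_lt_card) s.natDegree_pos.ne'

omit [Algebra F K] in
theorem SmallPoly.one_lt_base_sq (s : SmallPoly K t) : 1 < s.base F ^ 2 :=
  one_lt_pow₀ s.one_lt_base two_ne_zero

theorem SmallPoly.natCard_pow (hK : Module.finrank F K = 2) (s : SmallPoly K t) :
    (Nat.card K : ℝ) ^ s.poly.natDegree = s.base F ^ 2 := by
  rw [card_eq_sq hK, SmallPoly.base]
  push_cast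
  rw [← pow_mul, ← pow_mul, mul_comm]

theorem SmallPoly.poly_pairwise :
    Pairwise fun s s' : SmallPoly K t => IsCoprime s.poly s'.poly := SmallPoly.pairwise_isCoprime

theorem mulRoot_injective (k : SmallPoly K t → ℕ) :
    Function.Injective (mulRoot SmallPoly.poly k) :=
  Function.LeftInverse.injective (g := divRoot SmallPoly.poly k)
    (divRoot_mulRoot fun s => s.2.2.2.2)

theorem SmallPoly.base_tilde (hK : Module.finrank F K = 2) (s : SmallPoly K t) :
    (s.tilde hK).base F = s.base F :=
  congrArg ((Fintype.card F : ℝ) ^ ·) (s.natDegree_tilde hK)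

variable [Fintype (SmallPoly K t)]

/-- By `2kl ≤ k² + l²`, applied to the squares of both sides after symmetrising under the
involution. The bound decouples different polynomials. -/
theorem prod_base_pow_le (hK : Module.finrank F K = 2) (k : SmallPoly K t → ℕ) :
    ∏ s, s.base F ^ (k s * k (s.tilde hK)) ≤ ∏ s, s.base F ^ (k s ^ 2) := by
  have hinv : Function.Involutive (SmallPoly.tilde (t := t) hK) := SmallPoly.tilde_tilde hK
  have hpos : ∀ s : SmallPoly K t, 0 < s.base F := fun s => zero_lt_one.trans s.one_lt_base
  have h1 : ∏ s : SmallPoly K t, s.base F ^ (k (s.tilde hK) ^ 2) = ∏ s, s.base F ^ (k s ^ 2) := by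
    refine Fintype.prod_equiv hinv.toPerm _ _ fun s => ?_
    rw [Function.Involutive.coe_toPerm, s.base_tilde]
  refine (pow_le_pow_iff_left₀ (Finset.prod_nonneg fun s _ => (pow_pos (hpos s) _).le)
    (Finset.prod_nonneg fun s _ => (pow_pos (hpos s) _).le) two_ne_zero).1 ?_
  calc (∏ s, s.base F ^ (k s * k (s.tilde hK))) ^ 2
      = ∏ s, s.base F ^ (2 * (k s * k (s.tilde hK))) := by
        rw [← Finset.prod_pow]
        exact Finset.prod_congr rfl fun s _ => by rw [← pow_mul, mul_comm]
    _ ≤ ∏ s, s.base F ^ (k s ^ 2 + k (s.tilde hK) ^ 2) := by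
        refine Finset.prod_le_prod (fun s _ => (pow_pos (hpos s) _).le) fun s _ => ?_
        refine pow_le_pow_right₀ s.one_lt_base.le ?_
        zify
        nlinarith [sq_nonneg ((k s : ℤ) - k (s.tilde hK))]
    _ = (∏ s, s.base F ^ (k s ^ 2)) ^ 2 := by
        simp only [pow_add]
        rw [Finset.prod_mul_distrib, h1, pow_two]

variable [DecidableEq (SmallPoly K t)]

variable (F) in
/-- The inversion coefficient of a tuple of multiplicities. -/
def multiCoef (k : SmallPoly K t → ℕ) : ℝ := ∏ s, coef (s.base F ^ 2) (k s)

/-- Inclusion-exclusion for the absence of small factors. -/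
theorem summable_and_tsum_multiCoef (hK : Module.finrank F K = 2) {n : ℕ} (A : GU F K n) :
    (Summable fun k : SmallPoly K t → ℕ =>
      multiCoef F k * (Nat.card (equivEmb (mulRoot SmallPoly.poly k) (act A)) : ℝ)) ∧
    (∑' k : SmallPoly K t → ℕ,
      multiCoef F k * (Nat.card (equivEmb (mulRoot SmallPoly.poly k) (act A)) : ℝ)) =
      open Classical in if NoSmallFactor t
        ((A : Matrix.GeneralLinearGroup (Fin n) K) : Matrix (Fin n) (Fin n) K) then 1 else 0 := by
  classical
  have := finite_of_finrank_eq_two hK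
  let w : SmallPoly K t → ℕ := fun s => Module.finrank (AdjoinRoot s.poly) (kerAeval (act A) s.poly)
  have h1 : ∀ k : SmallPoly K t → ℕ,
      multiCoef F k * (Nat.card (equivEmb (mulRoot SmallPoly.poly k) (act A)) : ℝ) =
      ∏ s, coef (s.base F ^ 2) (k s) *
        ∏ i ∈ Finset.range (k s), ((s.base F ^ 2) ^ w s - (s.base F ^ 2) ^ i) := by
    intro k
    rw [card_equivEmb (act A) SmallPoly.poly_pairwise, multiCoef, ← Finset.prod_mul_distrib]
    simp only [SmallPoly.natCard_pow hK]
    rfl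
  have h2 := fun s : SmallPoly K t => hasSum_coef_mul_prod (s.one_lt_base_sq (F := F)) (w s)
  obtain ⟨h3, h4⟩ := summable_and_tsum_prod (fun (s : SmallPoly K t) k => coef (s.base F ^ 2) k *
    ∏ i ∈ Finset.range k, ((s.base F ^ 2) ^ w s - (s.base F ^ 2) ^ i)) fun s => (h2 s).summable.norm
  simp only [h1]
  refine ⟨h3.of_norm, ?_⟩
  rw [h4, Finset.prod_congr rfl fun s _ => (h2 s).tsum_eq, noSmallFactor_iff]
  split_ifs with h
  · exact Finset.prod_eq_one fun s _ => if_pos (h s)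
  · push Not at h
    obtain ⟨s, hs⟩ := h
    exact Finset.prod_eq_zero (Finset.mem_univ s) (if_neg hs)

/-- The number of pairs of an element of the coset `g SU_n` and an equivariant embedding. -/
def pairCount {n : ℕ} (g : GU F K n) (k : SmallPoly K t → ℕ) : ℕ :=
  Nat.card {p : GU F K n × (CyclicSum SmallPoly.poly k →ₗ[K] (Fin n → K)) //
    p.1 ∈ g • (SU F K n : Set (GU F K n)) ∧ p.2 ∈ equivEmb (mulRoot SmallPoly.poly k) (act p.1)}

/-- The inclusion-exclusion identity is summed over the coset, and the finite sum is exchanged with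
the series. -/
theorem proportion_eq_tsum (hK : Module.finrank F K = 2) {n : ℕ} (g : GU F K n) :
    proportion t (g • (SU F K n : Set (GU F K n))) =
      ∑' k : SmallPoly K t → ℕ, multiCoef F k * ((pairCount g k : ℝ) / Nat.card (SU F K n)) := by
  classical
  have := finite_of_finrank_eq_two hK
  have := Fintype.ofFinite (GU F K n)
  set S : Set (GU F K n) := g • (SU F K n : Set (GU F K n)) with hS
  have hcard : S.ncard = Nat.card (SU F K n) := by
    rw [hS, ← Set.image_smul, Set.ncard_image_of_injective _ (MulAction.injective g)]
    rfl
  have h1 : ((Set.ncard {A : GU F K n | A ∈ S ∧ NoSmallFactor t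
      ((A : Matrix.GeneralLinearGroup (Fin n) K) : Matrix (Fin n) (Fin n) K)} : ℕ) : ℝ) =
      ∑ A ∈ S.toFinset, if NoSmallFactor t
        ((A : Matrix.GeneralLinearGroup (Fin n) K) : Matrix (Fin n) (Fin n) K) then 1 else 0 := by
    rw [Finset.sum_boole, ← Set.ncard_coe_finset]
    congr 2
    ext A
    simp
  have h2 : ∀ k : SmallPoly K t → ℕ, (pairCount g k : ℝ) = ∑ A ∈ S.toFinset,
      (Nat.card (equivEmb (mulRoot SmallPoly.poly k) (act A)) : ℝ) := by
    intro k
    have : Finite (CyclicSum SmallPoly.poly k) := Module.finite_of_finite K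
    have : Finite (CyclicSum SmallPoly.poly k →ₗ[K] (Fin n → K)) := DFunLike.finite _
    have e : {p : GU F K n × (CyclicSum SmallPoly.poly k →ₗ[K] (Fin n → K)) //
        p.1 ∈ S ∧ p.2 ∈ equivEmb (mulRoot SmallPoly.poly k) (act p.1)} ≃
        Σ A : S.toFinset, equivEmb (mulRoot SmallPoly.poly k) (act A.1) :=
      { toFun := fun p => ⟨⟨p.1.1, Set.mem_toFinset.2 p.2.1⟩, ⟨p.1.2, p.2.2⟩⟩
        invFun := fun p => ⟨(p.1.1, p.2.1), Set.mem_toFinset.1 p.1.2, p.2.2⟩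
        left_inv := fun _ => rfl
        right_inv := fun _ => rfl }
    rw [pairCount, Nat.card_congr e, Nat.card_sigma, Nat.cast_sum]
    exact Finset.sum_coe_sort S.toFinset
      fun A => (Nat.card (equivEmb (mulRoot SmallPoly.poly k) (act A)) : ℝ)
  rw [proportion, h1, hcard, Finset.sum_congr rfl fun A _ =>
    (summable_and_tsum_multiCoef (t := t) hK A).2.symm,
    ← Summable.tsum_finsetSum fun A _ => (summable_and_tsum_multiCoef (t := t) hK A).1,
    ← tsum_div_const]
  refine tsum_congr fun k => ?_
  rw [h2, ← Finset.mul_sum, mul_div_assoc]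

theorem ncard_invHerm_smallPoly (hK : Module.finrank F K = 2) (k : SmallPoly K t → ℕ) :
    ((invHerm F (mulRoot SmallPoly.poly k)).ncard : ℝ) =
      ∏ s, s.base F ^ (k s * k (s.tilde hK)) := by
  rw [ncard_invHerm (φ := SmallPoly.poly) hK (fun s => s.2.2.2.2) (fun s => s.2.1)
    (fun s s' h => Subtype.ext h) (SmallPoly.tilde hK) fun s => rfl, Nat.cast_prod]
  refine Finset.prod_congr rfl fun s _ => ?_
  rw [SmallPoly.base, Nat.cast_pow, ← pow_mul, ← mul_assoc]
  congr 3
  exact s.natDegree_tilde hK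

-- Once decoupled by `prod_base_pow_le`, the dominating series is a product of the absolutely
-- convergent `selfCoef` series.
omit [DecidableEq (SmallPoly K t)] in
theorem summable_multiCoef_mul (hK : Module.finrank F K = 2) :
    Summable fun k : SmallPoly K t → ℕ =>
      ‖multiCoef F k‖ * ∏ s, s.base F ^ (k s * k (s.tilde hK)) := by
  have hpos : ∀ s : SmallPoly K t, 0 < s.base F := fun s => zero_lt_one.trans s.one_lt_base
  refine Summable.of_nonneg_of_le (fun k => mul_nonneg (norm_nonneg _)
    (Finset.prod_nonneg fun s _ => (pow_pos (hpos s) _).le))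
    (fun k => mul_le_mul_of_nonneg_left (prod_base_pow_le hK k) (norm_nonneg _)) ?_
  refine (summable_and_tsum_prod (fun (s : SmallPoly K t) k => selfCoef (s.base F) k)
    fun s => summable_selfCoef s.one_lt_base).1.congr fun k => ?_
  simp only [selfCoef]
  rw [Finset.prod_mul_distrib, norm_mul, Real.norm_of_nonneg
    (Finset.prod_nonneg fun s _ => (pow_pos (hpos s) _).le), multiCoef]

/-- Each term is constant in `n` from `n > 2 dim M_k` on, and is dominated throughout by `|Kˣ|`
times the absolute value of its limit. -/
theorem tendsto_proportion_tsum (hK : Module.finrank F K = 2) (g : (n : ℕ) → GU F K n) :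
    Tendsto (fun n : ℕ => proportion t (g n • (SU F K n : Set (GU F K n)))) atTop
      (𝓝 (∑' k : SmallPoly K t → ℕ,
        multiCoef F k * ∏ s, s.base F ^ (k s * k (s.tilde hK)))) := by
  have := finite_of_finrank_eq_two hK
  simp only [proportion_eq_tsum hK]
  have hSU : ∀ n, (0 : ℝ) < Nat.card (SU F K n) := fun n => by exact_mod_cast Nat.card_pos
  refine tendsto_tsum_of_dominated_convergence
    ((summable_multiCoef_mul (t := t) hK).mul_right (Nat.card Kˣ : ℝ)) (fun k => ?_)
    (Eventually.of_forall fun n k => ?_)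
  · refine tendsto_const_nhds.congr' ?_
    filter_upwards [eventually_gt_atTop (2 * Module.finrank K (CyclicSum SmallPoly.poly k))]
      with n hn
    rw [pairCount, card_equivEmb_pairs_SU hK _ (mulRoot_injective k) (g n) hn, Nat.cast_mul,
      mul_div_cancel_right₀ _ (hSU n).ne', ncard_invHerm_smallPoly hK]
  · rw [norm_mul, mul_assoc]
    refine mul_le_mul_of_nonneg_left ?_ (norm_nonneg _)
    rw [Real.norm_of_nonneg (by positivity), div_le_iff₀ (hSU n), ← ncard_invHerm_smallPoly hK,
      mul_assoc]
    exact_mod_cast card_equivEmb_pairs_le hK _ (mulRoot_injective k) (g n)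

end Limit

/-! ### Evaluation of the series -/

section Evaluation

variable {F K : Type*} [Field F] [Fintype F] [Field K] [Algebra F K] {t : ℕ}
  [Fintype (SmallPoly K t)]

/-- Summing over the second index first produces `coefSum` at `(b²)^n`, which vanishes for every `n
> 0`; only `coefSum (b²) 1` survives. -/
theorem hasSum_pair {b : ℝ} (hb : 1 < b) :
    (Summable fun p : ℕ × ℕ => ‖coef (b ^ 2) p.1 * b ^ (p.1 * p.2) *
      (coef (b ^ 2) p.2 * b ^ (p.2 * p.1))‖) ∧
    ∑' p : ℕ × ℕ, coef (b ^ 2) p.1 * b ^ (p.1 * p.2) * (coef (b ^ 2) p.2 * b ^ (p.2 * p.1)) =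
      ∏' i : ℕ, (1 - (b ^ 2)⁻¹ ^ (i + 1)) := by
  have hX : 1 < b ^ 2 := one_lt_pow₀ hb two_ne_zero
  have h0 : 0 < b := by positivity
  have hs : Summable fun p : ℕ × ℕ => ‖coef (b ^ 2) p.1 * b ^ (p.1 * p.2) *
      (coef (b ^ 2) p.2 * b ^ (p.2 * p.1))‖ := by
    refine Summable.of_nonneg_of_le (fun _ => norm_nonneg _) (fun p => ?_)
      (Summable.mul_norm (summable_selfCoef hb) (summable_selfCoef hb))
    have h1 : b ^ (p.1 * p.2) * b ^ (p.2 * p.1) ≤ b ^ (p.1 ^ 2) * b ^ (p.2 ^ 2) := by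
      rw [← pow_add, ← pow_add]
      refine pow_le_pow_right₀ hb.le ?_
      zify
      nlinarith [sq_nonneg ((p.1 : ℤ) - p.2)]
    simp only [selfCoef, norm_mul, norm_pow, Real.norm_of_nonneg h0.le]
    calc _ = ‖coef (b ^ 2) p.1‖ * ‖coef (b ^ 2) p.2‖ * (b ^ (p.1 * p.2) * b ^ (p.2 * p.1)) := by
          ring
      _ ≤ ‖coef (b ^ 2) p.1‖ * ‖coef (b ^ 2) p.2‖ * (b ^ (p.1 ^ 2) * b ^ (p.2 ^ 2)) := by gcongr
      _ = _ := by ring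
  refine ⟨hs, ?_⟩
  rw [hs.of_norm.tsum_prod, ← coefSum_one hX]
  have h2 : ∀ n, ∑' m, coef (b ^ 2) n * b ^ (n * m) * (coef (b ^ 2) m * b ^ (m * n)) =
      coef (b ^ 2) n * coefSum (b ^ 2) ((b ^ 2) ^ n) := by
    intro n
    rw [coefSum, ← tsum_mul_left]
    refine tsum_congr fun m => ?_
    rw [← pow_mul, ← pow_mul, mul_comm m n, show 2 * (n * m) = n * m + n * m by ring, pow_add]
    ring
  rw [tsum_congr h2, tsum_eq_single 0]
  · simp [coef_zero]
  · intro n hn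
    obtain ⟨m, rfl⟩ := Nat.exists_eq_succ_of_ne_zero hn
    rw [Nat.succ_eq_add_one, coefSum_pow_succ hX, mul_zero]

theorem tsum_multiCoef_eq (hK : Module.finrank F K = 2) [LinearOrder (SmallPoly K t)] :
    ∑' k : SmallPoly K t → ℕ, multiCoef F k * ∏ s, s.base F ^ (k s * k (s.tilde hK)) =
      (∏ s : {s : SmallPoly K t // s.tilde hK = s}, ∏' i : ℕ, (1 + (-(s.1.base F)⁻¹) ^ (i + 1))) *
      ∏ s : {s : SmallPoly K t // s < s.tilde hK},
        ∏' i : ℕ, (1 - (s.1.base F ^ 2)⁻¹ ^ (i + 1)) := by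
  have h := tsum_prod_involution (SmallPoly.tilde (t := t) hK) (SmallPoly.tilde_tilde hK)
    (fun s n m => coef (s.base F ^ 2) n * s.base F ^ (n * m))
    (fun s _ => (summable_selfCoef s.one_lt_base).congr fun n => by rw [selfCoef, pow_two n])
    (fun s _ => by
      simp only [s.base_tilde hK]
      exact (hasSum_pair s.one_lt_base).1)
  simp only [SmallPoly.base_tilde, (hasSum_pair (SmallPoly.one_lt_base _)).2, ← pow_two] at h
  simp only [multiCoef, ← Finset.prod_mul_distrib]
  rw [h]
  congr 1
  exact Finset.prod_congr rfl fun s _ => tsum_selfCoef s.1.one_lt_base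

end Evaluation

/-! ### Convergence of the products in the theorem -/

section Products

theorem one_div_neg_pow_mul (q : ℝ) (i j : ℕ) :
    1 / (-q) ^ ((i + 1) * j) = (((-q) ^ j)⁻¹) ^ (i + 1) := by
  rw [one_div, inv_pow, ← pow_mul, mul_comm]

theorem one_div_pow_two_mul (q : ℝ) (i j : ℕ) :
    1 / q ^ (2 * (i + 1) * j) = (((q ^ j) ^ 2)⁻¹) ^ (i + 1) := by
  rw [one_div, inv_pow, ← pow_mul, ← pow_mul]
  congr 2
  ring

theorem multipliable_neg {q : ℝ} (hq : 1 < q) {j : ℕ} (hj : 1 ≤ j) :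
    Multipliable fun i : ℕ => 1 + 1 / (-q) ^ ((i + 1) * j) := by
  have h := multipliable_one_add_mul_pow (r := ((-q) ^ j)⁻¹) (by
    rw [abs_inv, abs_pow, abs_neg, abs_of_pos (by positivity)]
    exact inv_lt_one_of_one_lt₀ (one_lt_pow₀ hq (by omega))) 1
  simpa only [one_mul, one_div_neg_pow_mul] using h

theorem multipliable_sq {q : ℝ} (hq : 1 < q) {j : ℕ} (hj : 1 ≤ j) :
    Multipliable fun i : ℕ => 1 - 1 / q ^ (2 * (i + 1) * j) := by
  have h := multipliable_one_add_mul_pow (r := ((q ^ j) ^ 2)⁻¹) (by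
    rw [abs_inv, abs_of_pos (by positivity)]
    exact inv_lt_one_of_one_lt₀ (one_lt_pow₀ (one_lt_pow₀ hq (by omega)) two_ne_zero)) (-1)
  simpa only [neg_one_mul, ← sub_eq_add_neg, one_div_pow_two_mul] using h

end Products

/-! ### Grouping polynomials by degree -/

section Counting

variable {F K : Type*} [Field F] [Fintype F] [Field K] [Algebra F K] {t : ℕ}

theorem natCard_fixed_eq_tildeN (hK : Module.finrank F K = 2) {j : ℕ} (hj : j ≤ t) :
    Nat.card {s : {s : SmallPoly K t // s.tilde hK = s} // s.1.poly.natDegree = j} =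
      tildeN F K j := by
  rw [tildeN, Set.ncard_def]
  refine Nat.card_congr
    { toFun := fun s => ⟨s.1.1.1, s.1.1.2.1, s.1.1.2.2.1, s.2, s.1.1.2.2.2.2,
        (congrArg Subtype.val s.1.2).symm⟩
      invFun := fun f => ⟨⟨⟨f.1, f.2.1, f.2.2.1, f.2.2.2.1.trans_le hj, f.2.2.2.2.1⟩,
        Subtype.ext f.2.2.2.2.2.symm⟩, f.2.2.2.1⟩
      left_inv := fun _ => rfl
      right_inv := fun _ => rfl }

/-- Each unordered pair is represented by its smaller member. -/
theorem natCard_lt_eq_tildeM (hK : Module.finrank F K = 2) [LinearOrder (SmallPoly K t)] {j : ℕ}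
    (hj : j ≤ t) :
    Nat.card {s : {s : SmallPoly K t // s < s.tilde hK} // s.1.poly.natDegree = j} =
      tildeM F K j := by
  rw [tildeM, Set.ncard_def]
  refine Nat.card_congr (Equiv.ofBijective
    (fun s => ⟨s(s.1.1.1, tildeConj F K s.1.1.1), s.1.1.1, s.1.1.2.1, s.1.1.2.2.1, s.2,
      s.1.1.2.2.2.2, fun h => s.1.2.ne (Subtype.ext h), rfl⟩) ⟨?_, ?_⟩)
  · rintro ⟨⟨a, ha⟩, ha'⟩ ⟨⟨b, hb⟩, hb'⟩ h
    have h1 : s(a.1, (a.tilde hK).1) = s(b.1, (b.tilde hK).1) := congrArg Subtype.val h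
    rcases Sym2.eq_iff.1 h1 with ⟨h2, -⟩ | ⟨h2, h3⟩
    · have h4 : a = b := Subtype.ext h2
      subst h4; rfl
    · have h4 : a = b.tilde hK := Subtype.ext h2
      have h5 : a.tilde hK = b := Subtype.ext h3
      rw [h5, h4] at ha
      exact absurd ha hb.not_gt
  · rintro ⟨p, f, hm, hi, hd, h0, hne, rfl⟩
    let s : SmallPoly K t := ⟨f, hm, hi, hd.trans_le hj, h0⟩
    rcases lt_trichotomy s (s.tilde hK) with h | h | h
    · exact ⟨⟨⟨s, h⟩, hd⟩, rfl⟩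
    · exact absurd (congrArg Subtype.val h) hne
    · refine ⟨⟨⟨s.tilde hK, by rwa [s.tilde_tilde]⟩, (s.natDegree_tilde hK).trans hd⟩, ?_⟩
      refine Subtype.ext ?_
      change s(tildeConj F K f, ((s.tilde hK).tilde hK).1) = _
      rw [s.tilde_tilde]
      exact Sym2.eq_swap

/-- Grouping a product over polynomials by degree. -/
theorem prod_eq_prod_pow_natCard {α : Type*} [Fintype α] (d : α → ℕ) (u : ℕ → ℝ)
    (hd : ∀ a, d a ∈ Finset.Icc 1 t) :
    ∏ a, u (d a) = ∏ j ∈ Finset.Icc 1 t, u j ^ Nat.card {a // d a = j} := by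
  classical
  rw [← Finset.prod_fiberwise_of_maps_to fun a _ => hd a]
  refine Finset.prod_congr rfl fun j _ => ?_
  rw [Finset.prod_congr rfl fun a ha => by rw [(Finset.mem_filter.1 ha).2], Finset.prod_const,
    Nat.card_eq_fintype_card, Fintype.card_subtype]

theorem SmallPoly.natDegree_mem_Icc (s : SmallPoly K t) : s.poly.natDegree ∈ Finset.Icc 1 t :=
  Finset.mem_Icc.2 ⟨s.natDegree_pos, s.2.2.2.1⟩

end Counting
end UnitaryCoset

end

/-! ### The main theorem -/

theorem mainTheorem6 {F K : Type*} [Field F] [Fintype F] [Field K] [Algebra F K]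
    (hK : Module.finrank F K = 2) (q : ℕ) (hq : Fintype.card F = q) (t : ℕ) :
    (∀ j : ℕ, 1 ≤ j →
      Multipliable (fun i : ℕ =>
        (1 + 1 / (-(q : ℝ)) ^ ((i + 1) * j)) ^ UnitaryCoset.tildeN F K j) ∧
      Multipliable (fun i : ℕ =>
        (1 - 1 / (q : ℝ) ^ (2 * (i + 1) * j)) ^ UnitaryCoset.tildeM F K j)) ∧
    ∀ g : (n : ℕ) → UnitaryCoset.GU F K n,
      Tendsto
        (fun n : ℕ => UnitaryCoset.proportion t
          (g n • (UnitaryCoset.SU F K n : Set (UnitaryCoset.GU F K n))))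
        atTop
        (𝓝 (∏ j ∈ Finset.Icc 1 t,
          ((∏' i : ℕ, (1 + 1 / (-(q : ℝ)) ^ ((i + 1) * j)) ^ UnitaryCoset.tildeN F K j) *
            ∏' i : ℕ, (1 - 1 / (q : ℝ) ^ (2 * (i + 1) * j)) ^ UnitaryCoset.tildeM F K j))) := by
  classical
  have hq1 : (1 : ℝ) < q := by
    rw [← hq]
    exact_mod_cast Fintype.one_lt_card
  refine ⟨fun j hj => ⟨(UnitaryCoset.multipliable_neg hq1 hj).pow _,
    (UnitaryCoset.multipliable_sq hq1 hj).pow _⟩, fun g => ?_⟩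
  have := UnitaryCoset.finite_of_finrank_eq_two hK
  have := UnitaryCoset.finite_smallPoly (K := K) t
  let _ : Fintype (UnitaryCoset.SmallPoly K t) := Fintype.ofFinite _
  -- An arbitrary order, used only to pick one polynomial from each conjugate pair.
  let _ : LinearOrder (UnitaryCoset.SmallPoly K t) :=
    LinearOrder.lift' (Fintype.equivFin _) (Fintype.equivFin _).injective
  have hlim := UnitaryCoset.tendsto_proportion_tsum (t := t) hK g
  rw [UnitaryCoset.tsum_multiCoef_eq hK] at hlim
  convert hlim using 2
  rw [Finset.prod_mul_distrib]
  congr 1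
  · have h1 : ∀ s : {s : UnitaryCoset.SmallPoly K t // s.tilde hK = s},
        ∏' i : ℕ, (1 + (-(s.1.base F)⁻¹) ^ (i + 1)) =
        ∏' i : ℕ, (1 + 1 / (-(q : ℝ)) ^ ((i + 1) * s.1.poly.natDegree)) := by
      intro s
      -- Oddness of the degree `j` gives `-(q^j)⁻¹ = ((-q)^j)⁻¹`, matching the stated product.
      have hodd : Odd s.1.poly.natDegree :=
        UnitaryCoset.odd_natDegree_of_eq_tildeConj hK s.1.2.2.2.2 s.1.2.2.1
          (congrArg Subtype.val s.2).symm
      simp only [UnitaryCoset.one_div_neg_pow_mul, hodd.neg_pow, UnitaryCoset.SmallPoly.base, hq,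
        inv_neg]
    rw [Finset.prod_congr rfl fun s _ => h1 s, UnitaryCoset.prod_eq_prod_pow_natCard
      (fun s : {s : UnitaryCoset.SmallPoly K t // s.tilde hK = s} => s.1.poly.natDegree)
      (fun j => ∏' i : ℕ, (1 + 1 / (-(q : ℝ)) ^ ((i + 1) * j))) fun s => s.1.natDegree_mem_Icc]
    refine Finset.prod_congr rfl fun j hj => ?_
    rw [Finset.mem_Icc] at hj
    rw [UnitaryCoset.natCard_fixed_eq_tildeN hK hj.2,
      (UnitaryCoset.multipliable_neg hq1 hj.1).tprod_pow]
  · have h1 : ∀ s : {s : UnitaryCoset.SmallPoly K t // s < s.tilde hK},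
        ∏' i : ℕ, (1 - (s.1.base F ^ 2)⁻¹ ^ (i + 1)) =
        ∏' i : ℕ, (1 - 1 / (q : ℝ) ^ (2 * (i + 1) * s.1.poly.natDegree)) := by
      intro s
      simp only [UnitaryCoset.one_div_pow_two_mul, UnitaryCoset.SmallPoly.base, hq]
    rw [Finset.prod_congr rfl fun s _ => h1 s, UnitaryCoset.prod_eq_prod_pow_natCard
      (fun s : {s : UnitaryCoset.SmallPoly K t // s < s.tilde hK} => s.1.poly.natDegree)
      (fun j => ∏' i : ℕ, (1 - 1 / (q : ℝ) ^ (2 * (i + 1) * j))) fun s => s.1.natDegree_mem_Icc]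
    refine Finset.prod_congr rfl fun j hj => ?_
    rw [Finset.mem_Icc] at hj
    rw [UnitaryCoset.natCard_lt_eq_tildeM hK hj.2,
      (UnitaryCoset.multipliable_sq hq1 hj.1).tprod_pow]
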